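/- Let $J$ be one of $\mathbb Z$, $\mathbb Z_+=\{n\in\mathbb Z: n\ge 0\}$, $\mathbb Z_-=\{n\in\mathbb Z: n\le 0\}$, and let $\mathbf a=(a_n)_{n\in J}\subset(0,\infty)$ satisfy $a_{n+1}\ge 2a_n$ whenever $n,n+1\in J$. For $t>0$ let $n_0=n_0(t)$ be the index $n$ with $n,n+1\in J$ and $a_n<t\le a_{n+1}$, if there is one; otherwise put $n_0(t)=0$ if $J=\mathbb Z_-$ and $t>a_0$, and $n_0(t)=-1$, with $a_{-1}:=0$, if $J=\mathbb Z_+$ and $t\le a_0$. Let $I_n(t)=(a_n-t,a_n]$ for $n\in J$ with $n>n_0(t)$, and $I_{n_0}(t)=[0,2a_{n_0}-t]$ (empty if $2a_{n_0}<t$). These sets are pairwise disjoint, and $V_{\mathbf a}(t)$ is the bounded operator on the complex Hilbert space $L^2(\mathbb R_+)$, $\mathbb R_+=[0,\infty)$, given by $$(V_{\mathbf a}(t)f)(x)=\begin{cases} f(2a_n-x-t), & x\in I_n(t),\ n\ge n_0(t),\\ 0, & \text{otherwise;}\end{cases}$$ put $V_{\mathbf a}(0)=0$. Let $(L(t))_{t\ge0}$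 and $(R(t))_{t\ge0}$ be the left and right shift semigroups on $L^2(\mathbb R_+)$, i.e. $(L(t)f)(x)=f(x+t)$, and $(R(t)f)(x)=f(x-t)$ for $x\ge t$, $(R(t)f)(x)=0$ for $x<t$. On the orthogonal direct sum $H=L^2(\mathbb R_+)\oplus L^2(\mathbb R_+)$ set $$T_{\mathbf a}(t)=\begin{pmatrix} L(t) & V_{\mathbf a}(t)\\ 0 & R(t)\end{pmatrix},\qquad t\ge 0 .$$ A bounded operator $T$ on $H$ is similar to a contraction if $\|RTR^{-1}\|\le 1$ for some invertible bounded operator $R$ on $H$. A $C_0$-semigroup $(T(t))_{t\ge0}$ on $H$ belongs to $\mathcal{SQC}(H)$ if it is similar to a quasi-contraction semigroup, i.e. if there are an invertible bounded operator $R$ on $H$ and $\lambda\in\mathbb R$ such that $\|RT(t)R^{-1}\|\le e^{\lambda t}$ for all $t\ge0$. Then $\mathcal T_{\mathbf a}=(T_{\mathbf a}(t))_{t\ge0}$ is a $C_0$-semigroup on $H$, and: (i) for every $t>0$, the operator $T_{\mathbf a}(t)$ is similar to a contraction if and only if $J=\mathbb Z_-$; (ii) $\mathcal T_{\mathbf a}\in\mathcal{SQC}(H)$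 if and only if $J=\mathbb Z_+$. -/

import Mathlib

open MeasureTheory Set Filter Topology

noncomputable section

namespace PackelSemigroup

/-! ### Similarity to contractions and to quasi-contraction semigroups -/

section Similarity

variable {H : Type*} [NormedAddCommGroup H] [InnerProductSpace ℂ H]

/-- The conjugate `R T R⁻¹` of a bounded operator by an invertible bounded operator. -/
def conjBy (R : H ≃L[ℂ] H) (T : H →L[ℂ] H) : H →L[ℂ] H :=
  (R : H →L[ℂ] H) ∘L T ∘L (R.symm : H →L[ℂ] H)

/-- `T` is similar to a contraction: `‖R T R⁻¹‖ ≤ 1` for some invertible bounded `R`. -/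
def IsSimilarToContraction (T : H →L[ℂ] H) : Prop :=
  ∃ R : H ≃L[ℂ] H, ‖conjBy R T‖ ≤ 1

/-- `(T t)_{t ≥ 0}` is a `C₀`-semigroup; values of `T` at negative times play no role. -/
structure IsC0Semigroup (T : ℝ → H →L[ℂ] H) : Prop where
  map_zero : T 0 = ContinuousLinearMap.id ℂ H
  map_add : ∀ s t : ℝ, 0 ≤ s → 0 ≤ t → T (s + t) = T s ∘L T t
  tendsto_zero : ∀ h : H, Tendsto (fun t => T t h) (𝓝[>] 0) (𝓝 h)

/-- `(S t)_{t ≥ 0}` is a quasi-contraction semigroup. -/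
def IsQuasiContraction (S : ℝ → H →L[ℂ] H) : Prop :=
  IsC0Semigroup S ∧ ∃ lam : ℝ, ∀ t : ℝ, 0 ≤ t → ‖S t‖ ≤ Real.exp (lam * t)

/-- The class `SQC(H)`: the `C₀`-semigroups on `H` that are similar, through one invertible
operator for all times, to a quasi-contraction semigroup. -/
def IsSQC (T : ℝ → H →L[ℂ] H) : Prop :=
  IsC0Semigroup T ∧
    ∃ R : H ≃L[ℂ] H, IsQuasiContraction (fun t => conjBy R (T t))

end Similarity

/-! ### Partial composition operators on `L²(ℝ₊)` -/

/-- Lebesgue measure on `ℝ₊ = [0, ∞)`. -/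
abbrev halfLine : Measure ℝ := volume.restrict (Ici (0 : ℝ))

/-- The complex Hilbert space `L²(ℝ₊)`. -/
abbrev L2 : Type := Lp ℂ 2 halfLine

/-- If `φ` maps `S` into `ℝ₊` without increasing Lebesgue measure, then `f ∘ φ` on `S`, extended
by zero, is in `L²(ℝ₊)` for each `f ∈ L²(ℝ₊)`. -/
theorem memLp_partialComp (φ : ℝ → ℝ) (S : Set ℝ) (hφ : Measurable φ) (hS : MeasurableSet S)
    (hle : (halfLine.restrict S).map φ ≤ halfLine) (f : L2) :
    MemLp (S.indicator (fun x => f (φ x))) 2 halfLine := by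
  rw [memLp_indicator_iff_restrict hS]
  exact ((Lp.memLp f).mono_measure hle).comp_of_map hφ.aemeasurable

theorem ae_partialComp (φ : ℝ → ℝ) (S : Set ℝ) (hφ : Measurable φ) (hS : MeasurableSet S)
    (hle : (halfLine.restrict S).map φ ≤ halfLine) {p : ℝ → Prop}
    (hp : ∀ᵐ y ∂halfLine, p y) : ∀ᵐ x ∂halfLine, x ∈ S → p (φ x) := by
  rw [← ae_restrict_iff' hS]
  exact ae_of_ae_map hφ.aemeasurable (hle.absolutelyContinuous.ae_le hp)

/-- The operator on `L²(ℝ₊)` sending `f` to the function equal to `f (φ x)` for `x ∈ S` and to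
`0` for the other `x`. -/
def partialComp (φ : ℝ → ℝ) (S : Set ℝ) (hφ : Measurable φ) (hS : MeasurableSet S)
    (hle : (halfLine.restrict S).map φ ≤ halfLine) : L2 →L[ℂ] L2 :=
  LinearMap.mkContinuous
    { toFun := fun f => (memLp_partialComp φ S hφ hS hle f).toLp _
      map_add' := by
        intro f g
        rw [← MemLp.toLp_add]
        refine MemLp.toLp_congr _ _ ?_
        filter_upwards [ae_partialComp φ S hφ hS hle (Lp.coeFn_add f g)] with x hx
        by_cases h : x ∈ S
        · rw [Pi.add_apply, indicator_of_mem h, indicator_of_mem h, indicator_of_mem h]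
          exact hx h
        · simp [h]
      map_smul' := by
        intro c f
        rw [RingHom.id_apply, ← MemLp.toLp_const_smul]
        refine MemLp.toLp_congr _ _ ?_
        filter_upwards [ae_partialComp φ S hφ hS hle (Lp.coeFn_smul c f)] with x hx
        by_cases h : x ∈ S
        · simp [h, hx h]
        · simp [h] }
    1 (by
      intro f
      simp only [LinearMap.coe_mk, AddHom.coe_mk, one_mul]
      rw [Lp.norm_toLp, Lp.norm_def]
      refine ENNReal.toReal_mono (Lp.memLp f).eLpNorm_ne_top ?_
      rw [eLpNorm_indicator_eq_eLpNorm_restrict hS]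
      have h1 := eLpNorm_map_measure (p := 2)
        ((Lp.memLp f).mono_measure hle).aestronglyMeasurable hφ.aemeasurable
      calc eLpNorm (fun x => f (φ x)) 2 (halfLine.restrict S)
          = eLpNorm f 2 ((halfLine.restrict S).map φ) := h1.symm
        _ ≤ eLpNorm f 2 halfLine := eLpNorm_mono_measure _ hle)

theorem coeFn_partialComp (φ : ℝ → ℝ) (S : Set ℝ) (hφ : Measurable φ) (hS : MeasurableSet S)
    (hle : (halfLine.restrict S).map φ ≤ halfLine) (f : L2) :
    partialComp φ S hφ hS hle f =ᵐ[halfLine] S.indicator (fun x => f (φ x)) :=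
  MemLp.coeFn_toLp (memLp_partialComp φ S hφ hS hle f)

/-! ### Shift semigroups on `L²(ℝ₊)` -/

theorem map_shift_le (s : ℝ) :
    (halfLine.restrict {x : ℝ | 0 ≤ x + s}).map (fun x => x + s) ≤ halfLine := by
  have hS : MeasurableSet {x : ℝ | 0 ≤ x + s} :=
    measurableSet_le measurable_const (measurable_id.add_const s)
  have hm : Measurable (fun x : ℝ => x + s) := measurable_id.add_const s
  refine Measure.le_iff.2 fun B hB => ?_
  rw [Measure.map_apply hm hB, Measure.restrict_apply (hm hB), Measure.restrict_apply hB]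
  calc halfLine ((fun x => x + s) ⁻¹' B ∩ {x : ℝ | 0 ≤ x + s})
      ≤ volume ((fun x => x + s) ⁻¹' B ∩ {x : ℝ | 0 ≤ x + s}) :=
        Measure.restrict_apply_le _ _
    _ = volume ((fun x => x + s) ⁻¹' (B ∩ Ici 0)) := rfl
    _ = volume (B ∩ Ici 0) := measure_preimage_add_right volume s _

/-- The shift `(shift s f)(x) = f (x + s)` where `x + s ∈ ℝ₊`, and `0` elsewhere. -/
def shift (s : ℝ) : L2 →L[ℂ] L2 :=
  partialComp (fun x => x + s) {x | 0 ≤ x + s} (measurable_id.add_const s)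
    (measurableSet_le measurable_const (measurable_id.add_const s)) (map_shift_le s)

/-- The left shift semigroup, `(L(t) f)(x) = f (x + t)`. -/
def leftShift (t : ℝ) : L2 →L[ℂ] L2 := shift t

/-- The right shift semigroup, `(R(t) f)(x) = f (x - t)` for `x ≥ t` and `0` for `x < t`. -/
def rightShift (t : ℝ) : L2 →L[ℂ] L2 := shift (-t)

/-! ### The operators `V_a(t)` -/

/-- `(a_n)_{n ∈ J}` is a sequence of positive numbers, indexed by `J = ℤ`, `ℤ₊` or `ℤ₋`, with
`a_{n+1} ≥ 2 a_n` whenever `n` and `n + 1` are in `J`. Values `a n` with `n ∉ J` play no role. -/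
structure IsLacunarySeq (J : Set ℤ) (a : ℤ → ℝ) : Prop where
  index : J = univ ∨ J = Ici 0 ∨ J = Iic 0
  pos : ∀ n ∈ J, 0 < a n
  two_mul_le : ∀ n, n ∈ J → n + 1 ∈ J → 2 * a n ≤ a (n + 1)

open Classical in
/-- The index `n₀(t)`: the `n` with `n, n + 1 ∈ J` and `a_n < t ≤ a_{n+1}` if there is one;
otherwise `0` if `t > a_0` (this occurs for `J = ℤ₋`), and `-1` if `t ≤ a_0`
(this occurs for `J = ℤ₊`). -/
def n₀ (J : Set ℤ) (a : ℤ → ℝ) (t : ℝ) : ℤ :=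
  if h : ∃ n : ℤ, n ∈ J ∧ n + 1 ∈ J ∧ a n < t ∧ t ≤ a (n + 1) then h.choose
  else if a 0 < t then 0 else -1

open Classical in
/-- The sets `I_n(t)`: `(a_n - t, a_n]` for `n ∈ J`, `n > n₀(t)`, and `[0, 2 a_{n₀} - t]` for
`n = n₀(t)`, where `a_{-1} = 0` if `n₀(t) = -1 ∉ J`. For all other `n` the set is empty. -/
def I (J : Set ℤ) (a : ℤ → ℝ) (t : ℝ) (n : ℤ) : Set ℝ :=
  if n = n₀ J a t then Icc 0 (2 * (if n ∈ J then a n else 0) - t)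
  else if n ∈ J ∧ n₀ J a t < n then Ioc (a n - t) (a n)
  else ∅

section Intervals

variable {J : Set ℤ} {a : ℤ → ℝ}

theorem IsLacunarySeq.two_mul_le_of_lt (ha : IsLacunarySeq J a) {m n : ℤ} (hm : m ∈ J)
    (hn : n ∈ J) (hmn : m < n) : 2 * a m ≤ a n := by
  have key : ∀ k : ℕ, m + 1 + k ∈ J → 2 * a m ≤ a (m + 1 + k) := by
    intro k
    induction k with
    | zero =>
      intro h
      simp only [Nat.cast_zero, add_zero] at h ⊢
      exact ha.two_mul_le m hm h
    | succ k ih =>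
      intro h
      have h1 : m + 1 + k ∈ J := by
        rcases ha.index with rfl | rfl | rfl
        · trivial
        · simp only [mem_Ici] at hm ⊢; omega
        · simp only [mem_Iic] at h ⊢; push_cast at h; omega
      have h2 := ha.two_mul_le _ h1 (by push_cast at h; rw [add_assoc]; exact h)
      have h3 := ha.pos _ h1
      have h4 := ih h1
      push_cast
      rw [← add_assoc]
      linarith
  obtain ⟨k, hk⟩ := Int.le.dest (show m + 1 ≤ n by omega)
  rw [← hk]
  exact key k (by rw [hk]; exact hn)

theorem IsLacunarySeq.lt_of_lt (ha : IsLacunarySeq J a) {m n : ℤ} (hm : m ∈ J)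
    (hn : n ∈ J) (hmn : m < n) : a m < a n := by
  have := ha.two_mul_le_of_lt hm hn hmn
  have := ha.pos m hm
  linarith

theorem IsLacunarySeq.exists_gt (ha : IsLacunarySeq J a) (h : ∀ n : ℤ, 0 ≤ n → n ∈ J) (t : ℝ) :
    ∃ n : ℤ, 0 ≤ n ∧ t < a n := by
  have key : ∀ k : ℕ, 2 ^ k * a 0 ≤ a k := by
    intro k
    induction k with
    | zero => simp
    | succ k ih =>
      have := ha.two_mul_le k (h _ (by omega)) (h _ (by omega))
      push_cast
      rw [pow_succ]
      linarith
  have h0 := ha.pos 0 (h 0 le_rfl)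
  obtain ⟨k, hk⟩ := pow_unbounded_of_one_lt (t / a 0) (one_lt_two)
  refine ⟨k, by omega, lt_of_lt_of_le ?_ (key k)⟩
  rwa [div_lt_iff₀ h0] at hk

theorem IsLacunarySeq.exists_lt (ha : IsLacunarySeq J a) (h : ∀ n : ℤ, n ≤ 0 → n ∈ J) {t : ℝ}
    (ht : 0 < t) : ∃ n : ℤ, n ≤ 0 ∧ a n < t := by
  have key : ∀ k : ℕ, 2 ^ k * a (-k) ≤ a 0 := by
    intro k
    induction k with
    | zero => simp
    | succ k ih =>
      have := ha.two_mul_le (-(k + 1)) (h _ (by omega)) (h _ (by omega))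
      rw [show -((k : ℤ) + 1) + 1 = -k by ring] at this
      push_cast
      rw [pow_succ]
      have h2 : (0 : ℝ) < 2 ^ k := by positivity
      nlinarith
  obtain ⟨k, hk⟩ := pow_unbounded_of_one_lt (a 0 / t) (one_lt_two)
  refine ⟨-k, by omega, ?_⟩
  rw [div_lt_iff₀ ht] at hk
  have h2 : (0 : ℝ) < 2 ^ k := by positivity
  have := key k
  exact lt_of_mul_lt_mul_left (this.trans_lt hk) h2.le

/-- `n₀(t)` separates the `n ∈ J` with `a_n < t` from those with `a_n ≥ t`. -/
theorem IsLacunarySeq.n₀_lt_iff (ha : IsLacunarySeq J a) {t : ℝ} (ht : 0 < t) {n : ℤ}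
    (hn : n ∈ J) : n₀ J a t < n ↔ t ≤ a n := by
  have hmono : ∀ {p q : ℤ}, p ∈ J → q ∈ J → p ≤ q → a p ≤ a q := by
    intro p q hp hq hpq
    rcases hpq.eq_or_lt with rfl | h
    · exact le_rfl
    · exact (ha.lt_of_lt hp hq h).le
  have up' : (∀ n : ℤ, n ∈ J → n + 1 ∈ J → a n < t → a (n + 1) < t) →
      ∀ p q : ℤ, p ∈ J → q ∈ J → p ≤ q → a p < t → a q < t := by
    intro h p q hp hq hpq hpt
    have up : ∀ k : ℕ, p + k ∈ J → a (p + k) < t := by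
      intro k
      induction k with
      | zero => intro _; simpa using hpt
      | succ k ih =>
        intro hk
        have hk' : p + k ∈ J := by
          rcases ha.index with rfl | rfl | rfl
          · trivial
          · simp only [mem_Ici] at hp ⊢; omega
          · simp only [mem_Iic] at hk ⊢; push_cast at hk; omega
        push_cast at hk ⊢
        rw [← add_assoc] at hk ⊢
        exact h _ hk' hk (ih hk')
    obtain ⟨k, hk⟩ := Int.le.dest hpq
    rw [← hk]
    exact up k (by rw [hk]; exact hq)
  unfold n₀
  split_ifs with h h0
  · obtain ⟨h1, h2, h3, h4⟩ := h.choose_spec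
    constructor
    · intro hlt
      exact h4.trans (hmono h2 hn (by omega))
    · intro hle
      by_contra hcon
      have := hmono hn h1 (not_lt.1 hcon)
      linarith
  all_goals push Not at h
  all_goals replace up' := up' h
  · have hJ : J = Iic 0 := by
      by_contra hne
      have hJ' : ∀ n : ℤ, 0 ≤ n → n ∈ J := by
        intro m hm
        rcases ha.index with rfl | rfl | rfl
        · trivial
        · exact hm
        · exact absurd rfl hne
      obtain ⟨m, hm, hmt⟩ := ha.exists_gt hJ' t
      exact absurd (up' 0 m (hJ' 0 le_rfl) (hJ' m hm) hm h0) (not_lt.2 hmt.le)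
    subst hJ
    simp only [mem_Iic] at hn
    have := hmono hn (show (0 : ℤ) ∈ Iic 0 by simp) hn
    constructor
    · intro; omega
    · intro; linarith
  · have hJ : J = Ici 0 := by
      by_contra hne
      have hJ' : ∀ n : ℤ, n ≤ 0 → n ∈ J := by
        intro m hm
        rcases ha.index with rfl | rfl | rfl
        · trivial
        · exact absurd rfl hne
        · exact hm
      obtain ⟨m, hm, hmt⟩ := ha.exists_lt hJ' ht
      exact h0 (up' m 0 (hJ' m hm) (hJ' 0 le_rfl) hm hmt)
    subst hJ
    have hn' : (0 : ℤ) ≤ n := hn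
    have := hmono (show (0 : ℤ) ∈ Ici 0 by simp) hn hn'
    constructor
    · intro
      exact (not_lt.1 h0).trans this
    · intro; omega

/-- If `n₀(t)` is not in `J`, then `n₀(t) = -1` and `J = ℤ₊`. -/
theorem IsLacunarySeq.lt_of_n₀_notMem (ha : IsLacunarySeq J a) {t : ℝ} (h0 : n₀ J a t ∉ J)
    {n : ℤ} (hn : n ∈ J) : n₀ J a t < n := by
  have h00 : (0 : ℤ) ∈ J := by rcases ha.index with rfl | rfl | rfl <;> simp
  revert h0
  unfold n₀
  split_ifs with h h1
  · exact fun h0 => absurd h.choose_spec.1 h0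
  · exact fun h0 => absurd h00 h0
  · intro h0
    rcases ha.index with rfl | rfl | rfl
    · simp at h0
    · simp only [mem_Ici] at hn; omega
    · simp at h0

/-- A description of `I_n(t)` that does not refer to `n₀(t)`. -/
theorem IsLacunarySeq.mem_I_iff (ha : IsLacunarySeq J a) {t : ℝ} (ht : 0 < t) {n : ℤ} {x : ℝ} :
    x ∈ I J a t n ↔ n ∈ J ∧ 0 ≤ x ∧ a n - t < x ∧ x ≤ a n ∧ x ≤ 2 * a n - t := by
  unfold I
  split_ifs with h1 h2 h3
  · have h4 : ¬ t ≤ a n := by rw [← ha.n₀_lt_iff ht h2, ← h1]; exact lt_irrefl _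
    simp only [mem_Icc, h2, true_and]
    constructor
    · rintro ⟨h5, h6⟩; refine ⟨h5, ?_, ?_, h6⟩ <;> linarith
    · rintro ⟨h5, -, -, h6⟩; exact ⟨h5, h6⟩
  · simp only [mem_Icc, h2, false_and, iff_false]
    rintro ⟨h5, h6⟩; linarith
  · have h4 := (ha.n₀_lt_iff ht h3.1).1 h3.2
    simp only [mem_Ioc, h3.1, true_and]
    constructor
    · rintro ⟨h5, h6⟩; refine ⟨?_, h5, h6, ?_⟩ <;> linarith
    · rintro ⟨-, h5, h6, -⟩; exact ⟨h5, h6⟩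
  · simp only [mem_empty_iff_false, false_iff]
    rintro ⟨h4, h5, h6, h7, h8⟩
    have h9 : ¬ n₀ J a t < n := fun h => h3 ⟨h4, h⟩
    have h10 : n < n₀ J a t := lt_of_le_of_ne (not_lt.1 h9) h1
    have h11 : n₀ J a t ∈ J := by
      by_contra hc
      exact h9 (ha.lt_of_n₀_notMem hc h4)
    have h12 := ha.two_mul_le_of_lt h4 h11 h10
    have h13 : ¬ t ≤ a (n₀ J a t) := by rw [← ha.n₀_lt_iff ht h11]; exact lt_irrefl _
    linarith

theorem IsLacunarySeq.eq_of_mem_I (ha : IsLacunarySeq J a) {t : ℝ} (ht : 0 < t) {m n : ℤ} {x : ℝ}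
    (hm : x ∈ I J a t m) (hn : x ∈ I J a t n) : m = n := by
  rw [ha.mem_I_iff ht] at hm hn
  obtain ⟨hm1, hm2, hm3, hm4, hm5⟩ := hm
  obtain ⟨hn1, hn2, hn3, hn4, hn5⟩ := hn
  rcases lt_trichotomy m n with h | h | h
  · have := ha.two_mul_le_of_lt hm1 hn1 h
    linarith
  · exact h
  · have := ha.two_mul_le_of_lt hn1 hm1 h
    linarith

theorem measurableSet_I (J : Set ℤ) (a : ℤ → ℝ) (t : ℝ) (n : ℤ) : MeasurableSet (I J a t n) := by
  unfold I
  split_ifs <;> measurability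

end Intervals

open Classical in
/-- The `n` with `x ∈ I_n(t)`; the value `0` for `x` outside all `I_n(t)` plays no role. -/
def blockIndex (J : Set ℤ) (a : ℤ → ℝ) (t x : ℝ) : ℤ :=
  if h : ∃ n, x ∈ I J a t n then h.choose else 0

/-- The map `x ↦ 2 a_n - x - t` for `x ∈ I_n(t)`. -/
def reflect (J : Set ℤ) (a : ℤ → ℝ) (t x : ℝ) : ℝ := 2 * a (blockIndex J a t x) - x - t

section Reflect

variable {J : Set ℤ} {a : ℤ → ℝ}

theorem IsLacunarySeq.blockIndex_eq (ha : IsLacunarySeq J a) {t : ℝ} (ht : 0 < t) {n : ℤ} {x : ℝ}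
    (hx : x ∈ I J a t n) : blockIndex J a t x = n := by
  have h : ∃ n, x ∈ I J a t n := ⟨n, hx⟩
  unfold blockIndex
  rw [dif_pos h]
  exact ha.eq_of_mem_I ht h.choose_spec hx

theorem IsLacunarySeq.measurable_reflect (ha : IsLacunarySeq J a) {t : ℝ} (ht : 0 < t) :
    Measurable (reflect J a t) := by
  have hB : Measurable (blockIndex J a t) := by
    refine measurable_to_countable' fun n => ?_
    have : blockIndex J a t ⁻¹' {n} =
        I J a t n ∪ ((⋃ m, I J a t m)ᶜ ∩ {_x : ℝ | n = 0}) := by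
      ext x
      simp only [mem_preimage, mem_singleton_iff, mem_union, mem_inter_iff, mem_compl_iff,
        mem_iUnion, mem_ofPred_eq]
      by_cases h : ∃ m, x ∈ I J a t m
      · obtain ⟨m, hm⟩ := h
        rw [ha.blockIndex_eq ht hm]
        constructor
        · rintro rfl; exact Or.inl hm
        · rintro (h | h)
          · exact ha.eq_of_mem_I ht hm h
          · exact absurd ⟨m, hm⟩ h.1
      · have h1 : blockIndex J a t x = 0 := dif_neg h
        rw [h1]
        constructor
        · rintro rfl; exact Or.inr ⟨h, rfl⟩
        · rintro (h2 | h2)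
          · exact absurd ⟨n, h2⟩ h
          · exact h2.2.symm
    rw [this]
    exact (measurableSet_I J a t n).union
      ((MeasurableSet.iUnion (measurableSet_I J a t)).compl.inter (MeasurableSet.const _))
  have h1 : Measurable fun x => a (blockIndex J a t x) := (measurable_of_countable a).comp hB
  exact ((h1.const_mul 2).sub measurable_id).sub_const t

theorem IsLacunarySeq.map_reflect_le (ha : IsLacunarySeq J a) {t : ℝ} (ht : 0 < t) :
    (halfLine.restrict (⋃ n, I J a t n)).map (reflect J a t) ≤ halfLine := by
  have hφ := ha.measurable_reflect ht
  refine Measure.le_iff.2 fun B hB => ?_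
  rw [Measure.map_apply hφ hB, Measure.restrict_apply (hφ hB), Measure.restrict_apply hB]
  set K : ℤ → Set ℝ := fun n => (B ∩ (fun y => 2 * a n - t - y) ⁻¹' I J a t n) with hK
  have hKm : ∀ n, MeasurableSet (K n) := fun n =>
    hB.inter ((measurable_const.sub measurable_id) (measurableSet_I J a t n))
  have hmem : ∀ n y, y ∈ K n → n ∈ J ∧ 0 ≤ y ∧ a n - t ≤ y ∧ y ≤ 2 * a n - t := by
    rintro n y ⟨-, hy⟩
    obtain ⟨h1, h2, h3, h4, h5⟩ := (ha.mem_I_iff ht).1 hy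
    exact ⟨h1, by linarith, by linarith, by linarith⟩
  have hdis : Pairwise (Function.onFun (AEDisjoint volume) K) := by
    have key : ∀ m n, m < n → AEDisjoint volume (K m) (K n) := by
      intro m n hmn
      refine measure_mono_null (t := {a n - t}) ?_ (by simp)
      rintro y ⟨hm, hn⟩
      obtain ⟨h1, -, -, h2⟩ := hmem m y hm
      obtain ⟨h3, -, h4, -⟩ := hmem n y hn
      have := ha.two_mul_le_of_lt h1 h3 hmn
      exact le_antisymm (by linarith) h4
    intro m n hmn
    rcases lt_or_gt_of_ne hmn with h | h
    · exact key m n h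
    · exact (key n m h).symm
  calc halfLine (reflect J a t ⁻¹' B ∩ ⋃ n, I J a t n)
      ≤ volume (reflect J a t ⁻¹' B ∩ ⋃ n, I J a t n) := Measure.restrict_apply_le _ _
    _ ≤ volume (⋃ n, (fun x => 2 * a n - t - x) ⁻¹' K n) := by
        refine measure_mono ?_
        rintro x ⟨hx, hx'⟩
        obtain ⟨n, hn⟩ := mem_iUnion.1 hx'
        refine mem_iUnion.2 ⟨n, ?_, ?_⟩
        · have : reflect J a t x = 2 * a n - t - x := by
            unfold reflect
            rw [ha.blockIndex_eq ht hn]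
            ring
          rw [mem_preimage, this] at hx
          exact hx
        · simpa using hn
    _ ≤ ∑' n, volume ((fun x => 2 * a n - t - x) ⁻¹' K n) := measure_iUnion_le _
    _ = ∑' n, volume (K n) := by
        congr 1
        ext n
        exact (Measure.measurePreserving_sub_left volume (2 * a n - t)).measure_preimage
          (hKm n).nullMeasurableSet
    _ = volume (⋃ n, K n) := (measure_iUnion₀ hdis fun n => (hKm n).nullMeasurableSet).symm
    _ ≤ volume (B ∩ Ici 0) := by
        refine measure_mono (iUnion_subset fun n y hy => ⟨hy.1, (hmem n y hy).2.1⟩)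

end Reflect

open Classical in
/-- For `t > 0`, `(V_a(t) f)(x) = f (2 a_n - x - t)` if `x ∈ I_n(t)`, and `0` if `x` is in no
`I_n(t)`; and `V_a(0) = 0`. -/
def V (J : Set ℤ) (a : ℤ → ℝ) (ha : IsLacunarySeq J a) (t : ℝ) : L2 →L[ℂ] L2 :=
  if ht : 0 < t then
    partialComp (reflect J a t) (⋃ n, I J a t n) (ha.measurable_reflect ht)
      (MeasurableSet.iUnion (measurableSet_I J a t)) (ha.map_reflect_le ht)
  else 0

/-- The formula that defines `V_a(t)`. -/
theorem coeFn_V {J : Set ℤ} {a : ℤ → ℝ} (ha : IsLacunarySeq J a) {t : ℝ} (ht : 0 < t) (f : L2) :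
    ∀ᵐ x ∂halfLine, (∀ n, x ∈ I J a t n → V J a ha t f x = f (2 * a n - x - t)) ∧
      ((∀ n, x ∉ I J a t n) → V J a ha t f x = 0) := by
  unfold V
  rw [dif_pos ht]
  filter_upwards [coeFn_partialComp (reflect J a t) (⋃ n, I J a t n) (ha.measurable_reflect ht)
      (MeasurableSet.iUnion (measurableSet_I J a t)) (ha.map_reflect_le ht) f] with x hx
  rw [hx]
  constructor
  · intro n hn
    rw [indicator_of_mem (mem_iUnion.2 ⟨n, hn⟩), reflect, ha.blockIndex_eq ht hn]
  · intro h
    exact indicator_of_notMem (by simpa using h) _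

/-- The Hilbert space `L²(ℝ₊) ⊕ L²(ℝ₊)` (orthogonal direct sum). -/
abbrev L2Sum : Type := WithLp 2 (L2 × L2)

/-- The Packel-type semigroup: `T_a(t)` is the block operator matrix with rows
`(L(t), V_a(t))` and `(0, R(t))`, so that `T_a(t) (f, g) = (L(t) f + V_a(t) g, R(t) g)`. -/
def T (J : Set ℤ) (a : ℤ → ℝ) (ha : IsLacunarySeq J a) (t : ℝ) : L2Sum →L[ℂ] L2Sum :=
  ((WithLp.prodContinuousLinearEquiv 2 ℂ L2 L2).symm : L2 × L2 →L[ℂ] L2Sum) ∘L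
    (((leftShift t).coprod (V J a ha t)).prod
      (rightShift t ∘L ContinuousLinearMap.snd ℂ L2 L2)) ∘L
    ((WithLp.prodContinuousLinearEquiv 2 ℂ L2 L2) : L2Sum →L[ℂ] L2 × L2)

end PackelSemigroup

end

/-!
The function `V(t) g` is the reflection of `g` in the nodes passed on the way from `x` to `x + t`,
so the semigroup law for `T` is the decomposition of the nodes in `[x, x + s + t)` into those in
`[x, x + s)` and those in `[x + s, x + s + t)`.

If the nodes are bounded, then `V(t) R(t)^N = 0` for large `N`; since `L(t) R(t) = 1`, this makes
`V(t)` a twisted commutator `L(t) Z - Z R(t)`, and a shear removes it.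

Suppose that `T` hardly increases some equivalent Hilbert norm, and consider many consecutive nodes.
Let `f_j` and `e_k` be bumps in the first summand near `a_j` and just below `2 a_k`,
respectively, and let `g_k` be a bump in the second summand near `0`. The left shift carries `f_l`
to `e_k` for `k < l` and `e_k` to `f_j` for `j < k`. Hence the squared norms of the `f_j` are
bounded and almost monotone, and there is a long run of nodes along which
`‖e_k‖² ≤ ‖f_j‖² + κ` for a fixed `j`. Since `g_k` is also reflected to `f_j`, the semigroup
carries `μ e_k + g_k` to `(1 + μ) f_j + d_{jk}` with `d_{jk}` in the second summand. Bessel's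
inequality makes the cross terms small for some `k` in the run, so the comparison of squared norms
bounds `2 μ ‖f_j‖²` independently of `μ`, up to a small error; this is absurd for large `μ`.
Nodes tending to infinity provide this configuration for the powers of a single `T(t)`, and nodes
tending to `0` provide it within an arbitrarily short time, where `exp (λ t)` is close to `1`.

If the nodes are separated, there is a weight which at least doubles across each node and otherwise
decays at most at a fixed exponential rate. In the corresponding weighted norms the growth across
the nodes compensates for the norm of `V(t)`.
-/

noncomputable section

namespace PackelSemigroup

/-! ### An obstruction to monotone Hilbert norms -/

section Obstruction

variable {𝕜 H ι : Type*} [RCLike 𝕜] [NormedAddCommGroup H] [InnerProductSpace 𝕜 H]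

theorem exists_lt_le_add_of_lt_mul {v : ℕ → ℝ} {B θ : ℝ} {P : ℕ} (h0 : 0 ≤ v 0) (hB : v P ≤ B)
    (hP : B < P * θ) : ∃ i < P, v (i + 1) ≤ v i + θ := by
  by_contra! hlt
  have hsum : ∑ _i ∈ Finset.range P, θ ≤ ∑ i ∈ Finset.range P, (v (i + 1) - v i) :=
    Finset.sum_le_sum fun i hi => by linarith [hlt i (Finset.mem_range.1 hi)]
  rw [Finset.sum_range_sub, Finset.sum_const, Finset.card_range, nsmul_eq_mul] at hsum
  linarith

theorem norm_smul_add_sq_real (c : ℝ) (x y : H) :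
    ‖(c : 𝕜) • x + y‖ ^ 2 = c ^ 2 * ‖x‖ ^ 2 + 2 * c * RCLike.re (inner 𝕜 x y) + ‖y‖ ^ 2 := by
  rw [norm_add_sq (𝕜 := 𝕜), norm_smul, inner_smul_left, RCLike.conj_ofReal, RCLike.re_ofReal_mul,
    RCLike.norm_ofReal, mul_pow, sq_abs]
  ring

variable (𝕜) in
/-- Bessel's inequality with constant `C` for the finite family `(e k)_{k ∈ s}`. It is what is left
of orthonormality after passing to an equivalent Hilbert norm. -/
def IsBesselFamily (C : ℝ) (s : Finset ι) (e : ι → H) : Prop :=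
  ∀ x : H, ∑ k ∈ s, ‖inner 𝕜 (e k) x‖ ^ 2 ≤ C * ‖x‖ ^ 2

theorem IsBesselFamily.mono {C : ℝ} {s s' : Finset ι} {e : ι → H}
    (he : IsBesselFamily 𝕜 C s e) (hs : s' ⊆ s) : IsBesselFamily 𝕜 C s' e := fun x =>
  (Finset.sum_le_sum_of_subset_of_nonneg hs fun _ _ _ => sq_nonneg _).trans (he x)

theorem IsBesselFamily.of_orthonormal {E : Type*} [NormedAddCommGroup E] [InnerProductSpace 𝕜 E]
    [CompleteSpace E] [CompleteSpace H] {K : ℝ} {s : Finset ι} {e : ι → E}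
    (he : Orthonormal 𝕜 fun k : s => e k) (U : E →L[𝕜] H) (hU : ‖U‖ ≤ K) :
    IsBesselFamily 𝕜 (K ^ 2) s fun k => U (e k) := by
  intro x
  calc ∑ k ∈ s, ‖inner 𝕜 (U (e k)) x‖ ^ 2
      = ∑ k : s, ‖inner 𝕜 (e k) (U.adjoint x)‖ ^ 2 := by
        simp only [U.adjoint_inner_right]
        exact (Finset.sum_coe_sort s fun k => ‖inner 𝕜 (U (e k)) x‖ ^ 2).symm
    _ ≤ ‖U.adjoint x‖ ^ 2 := he.sum_inner_products_le (U.adjoint x)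
    _ ≤ (K * ‖x‖) ^ 2 := by
        gcongr
        refine U.adjoint.le_of_opNorm_le ?_ x
        rwa [LinearIsometryEquiv.norm_map]
    _ = K ^ 2 * ‖x‖ ^ 2 := mul_pow _ _ _

theorem IsBesselFamily.exists_norm_inner_le {C κ : ℝ} {s : Finset ι} {e d : ι → H}
    (he : IsBesselFamily 𝕜 C s e) (hd : IsBesselFamily 𝕜 C s d) (hκ : 0 ≤ κ) (hs : s.Nonempty)
    {x y : H} (hcard : C * (‖x‖ ^ 2 + ‖y‖ ^ 2) ≤ s.card * κ ^ 2) :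
    ∃ k ∈ s, ‖inner 𝕜 (e k) x‖ ≤ κ ∧ ‖inner 𝕜 (d k) y‖ ≤ κ := by
  have hsum : ∑ k ∈ s, (‖inner 𝕜 (e k) x‖ ^ 2 + ‖inner 𝕜 (d k) y‖ ^ 2) ≤ ∑ _k ∈ s, κ ^ 2 := by
    rw [Finset.sum_add_distrib, Finset.sum_const, nsmul_eq_mul]
    linarith [he x, hd y]
  obtain ⟨k, hk, hle⟩ := Finset.exists_le_of_sum_le hs hsum
  refine ⟨k, hk, le_of_sq_le_sq ?_ hκ, le_of_sq_le_sq ?_ hκ⟩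
  · linarith [sq_nonneg ‖inner 𝕜 (d k) y‖]
  · linarith [sq_nonneg ‖inner 𝕜 (e k) x‖]

theorem two_mul_le_of_reflection {C c ε κ μ f e g d X Y : ℝ} (hμ : 0 ≤ μ) (hε : 0 ≤ ε)
    (hε1 : ε ≤ 1) (hεC : ε * C ≤ κ) (hcf : c ≤ f) (he : e ≤ C) (hef : e ≤ f + κ) (hX : X ≤ κ)
    (hY : -κ ≤ Y) (hg : g ≤ C) (hf : 0 ≤ f) (hg0 : 0 ≤ g) (hd : 0 ≤ d)
    (h : (1 + μ) ^ 2 * f + 2 * (1 + μ) * Y + d ≤ (1 + ε) * (μ ^ 2 * e + 2 * μ * X + g)) :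
    2 * μ * c ≤ κ * (2 * μ ^ 2 + 6 * μ + 2) + 2 * C := by
  have hκ : 0 ≤ κ := (mul_nonneg hε (hg0.trans hg)).trans hεC
  have hcross : 2 * (1 + μ) * -κ ≤ 2 * (1 + μ) * Y := by gcongr
  have henergy : (1 + ε) * (μ ^ 2 * e) ≤ μ ^ 2 * (f + 2 * κ) := by
    have : ε * e ≤ ε * C := by gcongr
    nlinarith [sq_nonneg μ]
  have hcross' : (1 + ε) * (2 * μ * X) ≤ 2 * (2 * μ * κ) := by
    have : (1 + ε) * (2 * μ * X) ≤ (1 + ε) * (2 * μ * κ) := by gcongr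
    nlinarith [mul_nonneg hμ hκ]
  have hrest : (1 + ε) * g ≤ 2 * C := by
    nlinarith
  nlinarith

/-- The orbits, in an equivalent Hilbert norm, of bumps reflected in `N + 1` consecutive nodes.
The bumps `f j` and `e k` move to the left, `f j` sits near the `j`-th node, and `e k` and `f j` are
the mirror images in the `k`-th node of the bumps `g k` and `d j k`, which move to the right. All
`g k` are close to each other. The dynamics takes `f l` to `e k` and `μ • e k + g k` to
`(1 + μ) • f j + d j k` whenever `j < k < l`, and increases the squared norm at most by the factor
`1 + ε`. -/
structure ReflectionSystem (𝕜 : Type*) {H : Type*} [RCLike 𝕜] [NormedAddCommGroup H]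
    [InnerProductSpace 𝕜 H] (N : ℕ) (c K ε : ℝ) (f e g : ℕ → H) (d : ℕ → ℕ → H) : Prop where
  le_norm_f : ∀ j ≤ N, c ≤ ‖f j‖ ^ 2
  norm_f_le : ∀ j ≤ N, ‖f j‖ ≤ K
  norm_e_le : ∀ k ≤ N, ‖e k‖ ≤ K
  norm_g_le : ∀ k ≤ N, ‖g k‖ ≤ K
  bessel_e : IsBesselFamily 𝕜 (K ^ 2) (Finset.Iic N) e
  bessel_d : ∀ j ≤ N, IsBesselFamily 𝕜 (K ^ 2) (Finset.Ioc j N) (d j)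
  norm_g_sub_le : ∀ k ≤ N, ‖g k - g 0‖ ≤ ε
  norm_e_le_norm_f : ∀ k l, k < l → l ≤ N → ‖e k‖ ^ 2 ≤ (1 + ε) * ‖f l‖ ^ 2
  reflect : ∀ j k, j < k → k ≤ N → ∀ μ : ℝ,
    ‖((1 + μ : ℝ) : 𝕜) • f j + d j k‖ ^ 2 ≤ (1 + ε) * ‖(μ : 𝕜) • e k + g k‖ ^ 2

namespace ReflectionSystem

variable {N M P : ℕ} {c K ε κ : ℝ} {f e g : ℕ → H} {d : ℕ → ℕ → H}

theorem exists_block (h : ReflectionSystem 𝕜 N c K ε f e g d) (hε : 0 ≤ ε)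
    (hN : P * (M + 1) ≤ N) (hP : K ^ 2 < P * (κ / 2)) (hεK : ε * K ^ 2 ≤ κ / 2) :
    ∃ j, j + M ≤ N ∧ ∀ k ∈ Finset.Ioc j (j + M), ‖e k‖ ^ 2 ≤ ‖f j‖ ^ 2 + κ := by
  have hf_sq_le : ∀ j ≤ N, ‖f j‖ ^ 2 ≤ K ^ 2 := fun j hj => by
    gcongr
    exact h.norm_f_le j hj
  obtain ⟨i, hiP, hi⟩ := exists_lt_le_add_of_lt_mul (v := fun i => ‖f (i * (M + 1))‖ ^ 2)
    (sq_nonneg _) (hf_sq_le _ hN) hP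
  have hlast : (i + 1) * (M + 1) ≤ N := (Nat.mul_le_mul_right _ hiP).trans hN
  rw [add_one_mul, ← add_assoc] at hlast
  simp only [add_one_mul, ← add_assoc] at hi
  refine ⟨i * (M + 1), by omega, fun k hk => ?_⟩
  rw [Finset.mem_Ioc] at hk
  have hek := h.norm_e_le_norm_f k (i * (M + 1) + M + 1) (by omega) hlast
  have hεf := mul_le_mul_of_nonneg_left (hf_sq_le _ hlast) hε
  linarith

theorem exists_almost_orthogonal (h : ReflectionSystem 𝕜 N c K ε f e g d) (hκ : 0 ≤ κ)
    (hεK : ε * K ≤ κ / 2) (hM0 : 0 < M) (hM : 2 * K ^ 4 ≤ M * (κ / 2) ^ 2) {j : ℕ}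
    (hj : j + M ≤ N) : ∃ k ∈ Finset.Ioc j (j + M),
      RCLike.re (inner 𝕜 (e k) (g k)) ≤ κ ∧ -κ ≤ RCLike.re (inner 𝕜 (f j) (d j k)) := by
  have hsub : Finset.Ioc j (j + M) ⊆ Finset.Ioc j N := Finset.Ioc_subset_Ioc_right hj
  have hcard : K ^ 2 * (‖g 0‖ ^ 2 + ‖f j‖ ^ 2) ≤
      (Finset.Ioc j (j + M)).card * (κ / 2) ^ 2 := by
    rw [Nat.card_Ioc, Nat.add_sub_cancel_left]
    calc K ^ 2 * (‖g 0‖ ^ 2 + ‖f j‖ ^ 2) ≤ K ^ 2 * (K ^ 2 + K ^ 2) := by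
          gcongr
          · exact h.norm_g_le 0 (by omega)
          · exact h.norm_f_le j (by omega)
      _ = 2 * K ^ 4 := by ring
      _ ≤ M * (κ / 2) ^ 2 := hM
  obtain ⟨k, hk, hek, hdk⟩ := IsBesselFamily.exists_norm_inner_le
    (h.bessel_e.mono (hsub.trans Finset.Ioc_subset_Iic_self))
    ((h.bessel_d j (by omega)).mono hsub) (by positivity)
    (Finset.nonempty_Ioc.2 (by omega)) hcard
  have hkN : k ≤ N := (Finset.mem_Ioc.1 (hsub hk)).2
  refine ⟨k, hk, ?_, ?_⟩
  · have hdiff : ‖inner 𝕜 (e k) (g k - g 0)‖ ≤ κ / 2 := by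
      refine (norm_inner_le_norm _ _).trans (le_trans ?_ hεK)
      rw [mul_comm]
      exact mul_le_mul (h.norm_g_sub_le k hkN) (h.norm_e_le k hkN) (norm_nonneg _)
        ((norm_nonneg _).trans (h.norm_g_sub_le k hkN))
    rw [← sub_add_cancel (g k) (g 0), inner_add_right, map_add]
    linarith [RCLike.re_le_norm (inner 𝕜 (e k) (g k - g 0)),
      RCLike.re_le_norm (inner 𝕜 (e k) (g 0))]
  · rw [inner_re_symm]
    linarith [neg_le_of_abs_le (RCLike.abs_re_le_norm (inner 𝕜 (d j k) (f j)))]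

theorem two_mul_le (h : ReflectionSystem 𝕜 N c K ε f e g d) (hε : 0 ≤ ε) (hε1 : ε ≤ 1) (hκ : 0 ≤ κ)
    (hεK : ε * K ≤ κ / 2) (hεK2 : ε * K ^ 2 ≤ κ / 2) (hN : P * (M + 1) ≤ N)
    (hP : K ^ 2 < P * (κ / 2)) (hM0 : 0 < M) (hM : 2 * K ^ 4 ≤ M * (κ / 2) ^ 2)
    {μ : ℝ} (hμ : 0 ≤ μ) : 2 * μ * c ≤ κ * (2 * μ ^ 2 + 6 * μ + 2) + 2 * K ^ 2 := by
  obtain ⟨j, hjM, hj⟩ := h.exists_block hε hN hP hεK2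
  obtain ⟨k, hk, hX, hY⟩ := h.exists_almost_orthogonal hκ hεK hM0 hM hjM
  have hjk := Finset.mem_Ioc.1 hk
  have hkN : k ≤ N := hjk.2.trans hjM
  have hreflect := h.reflect j k hjk.1 hkN μ
  rw [norm_smul_add_sq_real, norm_smul_add_sq_real] at hreflect
  exact two_mul_le_of_reflection hμ hε hε1 (by linarith) (h.le_norm_f j (by omega))
    (pow_le_pow_left₀ (norm_nonneg _) (h.norm_e_le k hkN) 2) (hj k hk) hX hY
    (pow_le_pow_left₀ (norm_nonneg _) (h.norm_g_le k hkN) 2) (sq_nonneg _) (sq_nonneg _)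
    (sq_nonneg _) hreflect

end ReflectionSystem

theorem exists_not_reflectionSystem {c K : ℝ} (hc : 0 < c) (hK : 1 ≤ K) : ∃ (N : ℕ) (ε : ℝ),
    0 < ε ∧ ∀ (f e g : ℕ → H) (d : ℕ → ℕ → H), ¬ ReflectionSystem 𝕜 N c K ε f e g d := by
  set μ : ℝ := 2 * K ^ 2 / c with hμ
  set κ : ℝ := K ^ 2 / (2 * μ ^ 2 + 6 * μ + 2) with hκ
  have hμ0 : 0 ≤ μ := by positivity
  have hκ0 : 0 < κ := by positivity
  have hκK : κ ≤ K ^ 2 := div_le_self (sq_nonneg K) (by nlinarith)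
  obtain ⟨M, hM⟩ := exists_nat_gt (2 * K ^ 4 / (κ / 2) ^ 2)
  obtain ⟨P, hP⟩ := exists_nat_gt (K ^ 2 / (κ / 2))
  have hM0 : 0 < M := Nat.cast_pos.1 (lt_of_le_of_lt (by positivity) hM)
  rw [div_lt_iff₀ (by positivity)] at hM hP
  have hεK2 : κ / (2 * K ^ 2) * K ^ 2 = κ / 2 := by field_simp
  have hε1 : κ / (2 * K ^ 2) ≤ 1 := by
    rw [div_le_one (by positivity)]
    linarith
  refine ⟨P * (M + 1), κ / (2 * K ^ 2), by positivity, fun f e g d h => ?_⟩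
  have hεK : κ / (2 * K ^ 2) * K ≤ κ / 2 := by
    rw [← hεK2]
    gcongr
    exact le_self_pow₀ hK two_ne_zero
  have hle := h.two_mul_le (by positivity) hε1 hκ0.le hεK hεK2.le le_rfl hP hM0 hM.le hμ0
  have hμc : μ * c = 2 * K ^ 2 := by rw [hμ]; field_simp
  have hκμ : κ * (2 * μ ^ 2 + 6 * μ + 2) = K ^ 2 := by rw [hκ]; field_simp
  nlinarith

end Obstruction

/-! ### Shifts -/

section Shift

/-- The extension by zero of `f ∈ L²(ℝ₊)` to the real line. In terms of it the shifts and the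
operators `V_a(t)` are given by formulas without case distinctions. -/
def zeroExt (f : L2) : ℝ → ℂ := (Ici 0).indicator f

theorem zeroExt_of_nonneg (f : L2) {x : ℝ} (hx : 0 ≤ x) : zeroExt f x = f x :=
  indicator_of_mem (mem_Ici.2 hx) _

theorem zeroExt_of_neg (f : L2) {x : ℝ} (hx : x < 0) : zeroExt f x = 0 :=
  indicator_of_notMem (notMem_Ici.2 hx) _

theorem ae_halfLine_iff {p : ℝ → Prop} : (∀ᵐ x ∂halfLine, p x) ↔ ∀ᵐ x, 0 ≤ x → p x :=
  ae_restrict_iff' measurableSet_Ici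

theorem memLp_zeroExt (f : L2) : MemLp (zeroExt f) 2 :=
  (memLp_indicator_iff_restrict measurableSet_Ici).2 (Lp.memLp f)

theorem ext_zeroExt {f g : L2} (h : ∀ᵐ x, 0 ≤ x → zeroExt f x = zeroExt g x) : f = g := by
  refine Lp.ext (ae_halfLine_iff.2 ?_)
  filter_upwards [h] with x hx h0
  rw [← zeroExt_of_nonneg f h0, ← zeroExt_of_nonneg g h0, hx h0]

theorem zeroExt_add (f g : L2) :
    ∀ᵐ x, 0 ≤ x → zeroExt (f + g) x = zeroExt f x + zeroExt g x := by
  filter_upwards [ae_halfLine_iff.1 (Lp.coeFn_add f g)] with x hx h0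
  simp only [zeroExt_of_nonneg _ h0, hx h0, Pi.add_apply]

theorem enorm_partialComp_le (φ : ℝ → ℝ) {S B : Set ℝ} (hφ : Measurable φ) (hS : MeasurableSet S)
    (hle : (halfLine.restrict S).map φ ≤ halfLine) (hB : MeasurableSet B) (hSB : MapsTo φ S B)
    (f : L2) : ‖partialComp φ S hφ hS hle f‖ₑ ≤ eLpNorm f 2 (halfLine.restrict B) := by
  have hmap : (halfLine.restrict S).map φ ≤ halfLine.restrict B := by
    rw [← Measure.restrict_eq_self_of_ae_mem (s := B) (μ := (halfLine.restrict S).map φ)]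
    · exact Measure.restrict_mono subset_rfl hle
    · refine (ae_map_iff hφ.aemeasurable hB).2 ?_
      filter_upwards [ae_restrict_mem hS] with x hx using hSB hx
  calc ‖partialComp φ S hφ hS hle f‖ₑ = eLpNorm (fun x => f (φ x)) 2 (halfLine.restrict S) := by
        rw [Lp.enorm_def, eLpNorm_congr_ae (coeFn_partialComp φ S hφ hS hle f),
          eLpNorm_indicator_eq_eLpNorm_restrict hS]
    _ = eLpNorm f 2 ((halfLine.restrict S).map φ) :=
        (eLpNorm_map_measure ((Lp.memLp f).mono_measure hle).aestronglyMeasurable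
          hφ.aemeasurable).symm
    _ ≤ eLpNorm f 2 (halfLine.restrict B) := eLpNorm_mono_measure _ hmap

theorem norm_partialComp_le_one (φ : ℝ → ℝ) {S : Set ℝ} (hφ : Measurable φ)
    (hS : MeasurableSet S) (hle : (halfLine.restrict S).map φ ≤ halfLine) :
    ‖partialComp φ S hφ hS hle‖ ≤ 1 :=
  LinearMap.mkContinuous_norm_le _ zero_le_one _

theorem zeroExt_shift (s : ℝ) (f : L2) :
    ∀ᵐ x, 0 ≤ x → zeroExt (shift s f) x = zeroExt f (x + s) := by
  filter_upwards [ae_halfLine_iff.1 (coeFn_partialComp _ _ _ _ (map_shift_le s) f)] with x hx h0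
  rw [zeroExt_of_nonneg _ h0, shift, hx h0]
  rfl

theorem zeroExt_rightShift {t : ℝ} (ht : 0 ≤ t) (f : L2) :
    ∀ᵐ x, zeroExt (rightShift t f) x = zeroExt f (x - t) := by
  filter_upwards [zeroExt_shift (-t) f] with x hx
  rcases lt_or_ge x 0 with h0 | h0
  · rw [zeroExt_of_neg _ h0, zeroExt_of_neg _ (by linarith)]
  · exact hx h0

theorem norm_shift_le_one (s : ℝ) : ‖shift s‖ ≤ 1 := norm_partialComp_le_one _ _ _ _

theorem ae_comp_add {p : ℝ → Prop} (hp : ∀ᵐ x, p x) (s : ℝ) : ∀ᵐ x, p (x + s) :=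
  (measurePreserving_add_right volume s).quasiMeasurePreserving.ae hp

theorem ae_comp_sub_left {p : ℝ → Prop} (hp : ∀ᵐ x, p x) (s : ℝ) : ∀ᵐ x, p (s - x) :=
  (Measure.measurePreserving_sub_left volume s).quasiMeasurePreserving.ae hp

theorem shift_comp_shift {s t : ℝ} (h : 0 ≤ s ∨ t ≤ 0) :
    shift s ∘L shift t = shift (s + t) := by
  ext1 f
  refine ext_zeroExt ?_
  filter_upwards [zeroExt_shift s (shift t f), ae_comp_add (zeroExt_shift t f) s,
    zeroExt_shift (s + t) f] with x hs ht hst h0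
  rw [ContinuousLinearMap.comp_apply, hs h0, hst h0, ← add_assoc]
  rcases le_or_gt 0 (x + s) with hxs | hxs
  · exact ht hxs
  · rw [zeroExt_of_neg _ hxs, zeroExt_of_neg]
    rcases h with h | h <;> linarith

theorem shift_zero : shift 0 = ContinuousLinearMap.id ℂ L2 := by
  ext1 f
  refine ext_zeroExt ?_
  filter_upwards [zeroExt_shift 0 f] with x hx h0
  rw [hx h0, add_zero, ContinuousLinearMap.id_apply]

theorem leftShift_comp_rightShift {t : ℝ} (ht : 0 ≤ t) :
    leftShift t ∘L rightShift t = ContinuousLinearMap.id ℂ L2 := by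
  rw [leftShift, rightShift, shift_comp_shift (Or.inl ht), add_neg_cancel, shift_zero]

theorem leftShift_add {s t : ℝ} (hs : 0 ≤ s) : leftShift (s + t) = leftShift s ∘L leftShift t :=
  (shift_comp_shift (Or.inl hs)).symm

theorem rightShift_add {s t : ℝ} (ht : 0 ≤ t) :
    rightShift (s + t) = rightShift s ∘L rightShift t := by
  rw [rightShift, neg_add, ← shift_comp_shift (Or.inr (neg_nonpos.2 ht))]
  rfl

theorem shift_eq_restrict_vadd (s : ℝ) (f : L2) : shift s f =
    LpToLpRestrictCLM ℝ ℂ ℂ volume 2 (Ici 0) (DomAddAct.mk s +ᵥ (memLp_zeroExt f).toLp) := by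
  refine Lp.ext ?_
  have hvadd := DomAddAct.vadd_Lp_ae_eq (DomAddAct.mk s) (memLp_zeroExt f).toLp
  have htoLp := ae_comp_add (memLp_zeroExt f).coeFn_toLp s
  filter_upwards [LpToLpRestrictCLM_coeFn ℂ (Ici (0 : ℝ))
      (DomAddAct.mk s +ᵥ (memLp_zeroExt f).toLp),
    ae_halfLine_iff.2 (zeroExt_shift s f), ae_restrict_of_ae hvadd, ae_restrict_of_ae htoLp,
    ae_restrict_mem measurableSet_Ici] with x hrestrict hshift hvadd htoLp h0
  rw [hrestrict, hvadd, ← zeroExt_of_nonneg _ h0, hshift, ← htoLp, add_comm x s]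
  rfl

theorem continuous_shift_apply (f : L2) : Continuous fun s => shift s f := by
  have : Fact ((2 : ENNReal) ≠ ⊤) := ⟨by simp⟩
  have : Continuous fun s : ℝ => DomAddAct.mk s := DomAddAct.continuous_mk
  simp only [shift_eq_restrict_vadd]
  fun_prop

end Shift

/-! ### The operators `V_a(t)` -/

section Crossing

variable {J : Set ℤ} {a : ℤ → ℝ}

/-- The indices of the nodes `a_n` that lie in `[x, x + t)`, that is, those passed on the way from
`x` to `x + t`. -/
def crossed (J : Set ℤ) (a : ℤ → ℝ) (x t : ℝ) : Set ℤ := {n | n ∈ J ∧ a n ∈ Ico x (x + t)}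

theorem crossed_of_nonpos (J : Set ℤ) (a : ℤ → ℝ) (x : ℝ) {t : ℝ} (ht : t ≤ 0) :
    crossed J a x t = ∅ := by
  simp [crossed, Ico_eq_empty_of_le (show x + t ≤ x by linarith)]

theorem crossed_add (J : Set ℤ) (a : ℤ → ℝ) (x : ℝ) {s t : ℝ} (hs : 0 ≤ s) (ht : 0 ≤ t) :
    crossed J a x (s + t) = crossed J a x s ∪ crossed J a (x + s) t := by
  ext n
  simp only [crossed, ← add_assoc, mem_union, mem_ofPred_eq, ← and_or_left,
    ← Ico_union_Ico_eq_Ico (show x ≤ x + s by linarith) (show x + s ≤ x + s + t by linarith)]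

theorem disjoint_crossed (J : Set ℤ) (a : ℤ → ℝ) (x s t : ℝ) :
    Disjoint (crossed J a x s) (crossed J a (x + s) t) :=
  disjoint_left.2 fun _ hn hn' => (hn.2.2.trans_le hn'.2.1).false

theorem IsLacunarySeq.le_of_le (ha : IsLacunarySeq J a) {j k : ℤ} (hj : j ∈ J) (hk : k ∈ J)
    (hjk : j ≤ k) : a j ≤ a k := by
  rcases hjk.eq_or_lt with rfl | hlt
  · rfl
  · exact (ha.lt_of_lt hj hk hlt).le

theorem IsLacunarySeq.eq_of_mem_crossed (ha : IsLacunarySeq J a) {x t : ℝ} {m n : ℤ}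
    (hm : m ∈ crossed J a x t) (hm' : 0 ≤ 2 * a m - x - t) (hn : n ∈ crossed J a x t)
    (hn' : 0 ≤ 2 * a n - x - t) : m = n := by
  rcases lt_trichotomy m n with hmn | hmn | hmn
  · linarith [ha.two_mul_le_of_lt hm.1 hn.1 hmn, hn.2.2]
  · exact hmn
  · linarith [ha.two_mul_le_of_lt hn.1 hm.1 hmn, hm.2.2]

theorem IsLacunarySeq.mem_I_iff_crossed (ha : IsLacunarySeq J a) {x t : ℝ} (ht : 0 < t)
    (hx : 0 ≤ x) {n : ℤ} : x ∈ I J a t n ↔ n ∈ crossed J a x t ∧ 0 ≤ 2 * a n - x - t := by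
  rw [ha.mem_I_iff ht, crossed, mem_ofPred_eq, mem_Ico]
  constructor
  · rintro ⟨hn, -, hlt, hle, hle'⟩
    exact ⟨⟨hn, hle, by linarith⟩, by linarith⟩
  · rintro ⟨⟨hn, hle, hlt⟩, hle'⟩
    exact ⟨hn, hx, by linarith, hle, by linarith⟩

theorem IsLacunarySeq.finite_crossed_inter_support (ha : IsLacunarySeq J a) (x t : ℝ) (g : L2) :
    (crossed J a x t ∩ Function.support fun n => zeroExt g (2 * a n - x - t)).Finite := by
  refine Set.Subsingleton.finite fun m hm n hn => ?_
  have hnonneg : ∀ k, zeroExt g (2 * a k - x - t) ≠ 0 → 0 ≤ 2 * a k - x - t := fun k hk =>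
    not_lt.1 fun hlt => hk (zeroExt_of_neg g hlt)
  exact ha.eq_of_mem_crossed hm.1 (hnonneg m hm.2) hn.1 (hnonneg n hn.2)

/-- At most one summand is nonzero: if two nodes are crossed, the lower one is reflected out of
`ℝ₊`. -/
theorem zeroExt_V (ha : IsLacunarySeq J a) (t : ℝ) (g : L2) : ∀ᵐ x, 0 ≤ x →
    zeroExt (V J a ha t g) x = ∑ᶠ n ∈ crossed J a x t, zeroExt g (2 * a n - x - t) := by
  rcases le_or_gt t 0 with ht | ht
  · filter_upwards [ae_halfLine_iff.1 (Lp.coeFn_zero ℂ 2 halfLine)] with x hx h0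
    rw [crossed_of_nonpos J a x ht, finsum_mem_empty, V, dif_neg ht.not_gt, zeroExt_of_nonneg _ h0]
    exact hx h0
  filter_upwards [ae_halfLine_iff.1 (coeFn_V ha ht g)] with x hx h0
  obtain ⟨hmem, hnotMem⟩ := hx h0
  rw [zeroExt_of_nonneg _ h0]
  by_cases h : ∃ n, x ∈ I J a t n
  · obtain ⟨n, hn⟩ := h
    obtain ⟨hn', hnonneg⟩ := (ha.mem_I_iff_crossed ht h0).1 hn
    rw [hmem n hn, ← zeroExt_of_nonneg _ hnonneg,
      ← finsum_mem_singleton (a := n) (f := fun n => zeroExt g (2 * a n - x - t))]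
    refine finsum_mem_inter_support_eq' _ _ _ fun m hm => ⟨fun hmn => hmn ▸ hn', fun hm' => ?_⟩
    exact ha.eq_of_mem_crossed hm' (not_lt.1 fun hlt => hm (zeroExt_of_neg g hlt)) hn' hnonneg
  · rw [hnotMem (not_exists.1 h)]
    refine (finsum_mem_of_eqOn_zero fun n hn => zeroExt_of_neg g (not_le.1 fun hle => h ?_)).symm
    exact ⟨n, (ha.mem_I_iff_crossed ht h0).2 ⟨hn, hle⟩⟩

/-- The cocycle identity: the nodes in `[x, x + s + t)` are those in `[x, x + s)` together with
those in `[x + s, x + s + t)`. -/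
theorem V_add (ha : IsLacunarySeq J a) {s t : ℝ} (hs : 0 ≤ s) (ht : 0 ≤ t) :
    V J a ha (s + t) = leftShift s ∘L V J a ha t + V J a ha s ∘L rightShift t := by
  ext1 g
  refine ext_zeroExt ?_
  have hright : ∀ᵐ x, ∀ n : ℤ, zeroExt (rightShift t g) (2 * a n - s - x) =
      zeroExt g (2 * a n - s - x - t) :=
    ae_all_iff.2 fun n => ae_comp_sub_left (zeroExt_rightShift ht g) (2 * a n - s)
  filter_upwards [zeroExt_V ha (s + t) g, zeroExt_shift s (V J a ha t g),
    ae_comp_add (zeroExt_V ha t g) s, zeroExt_V ha s (rightShift t g), hright,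
    zeroExt_add (leftShift s (V J a ha t g)) (V J a ha s (rightShift t g))]
    with x hst hshift hleft hVright hright hadd h0
  have hfin := ha.finite_crossed_inter_support x (s + t) g
  rw [crossed_add J a x hs ht, union_inter_distrib_right, finite_union] at hfin
  rw [hst h0, crossed_add J a x hs ht,
    finsum_mem_union' (disjoint_crossed J a x s t) hfin.1 hfin.2, add_comm]
  refine .trans ?_ (hadd h0).symm
  rw [leftShift, hshift h0, hleft (by linarith), hVright h0]
  refine congrArg₂ (· + ·) (finsum_mem_congr rfl fun n _ => ?_) (finsum_mem_congr rfl fun n _ => ?_)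
  · ring_nf
  · rw [sub_right_comm (2 * a n) x s, hright n]
    ring_nf

/-- The points `y` for which some node lies in `(y, y + t]`. Up to a null set, the operator `V_a(t)`
only depends on the restriction of a function to this set. -/
def crossing (J : Set ℤ) (a : ℤ → ℝ) (t : ℝ) : Set ℝ := ⋃ n ∈ J, Ico (a n - t) (a n)

theorem mem_crossing {t y : ℝ} : y ∈ crossing J a t ↔ ∃ n ∈ J, a n - t ≤ y ∧ y < a n := by
  simp only [crossing, mem_iUnion₂, mem_Ico, exists_prop]

theorem measurableSet_crossing (J : Set ℤ) (a : ℤ → ℝ) (t : ℝ) :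
    MeasurableSet (crossing J a t) :=
  .biUnion (to_countable J) fun _ _ => measurableSet_Ico

theorem enorm_V_le (ha : IsLacunarySeq J a) (t : ℝ) (g : L2) :
    ‖V J a ha t g‖ₑ ≤ eLpNorm g 2 (halfLine.restrict (crossing J a t)) := by
  unfold V
  split_ifs with ht
  · refine enorm_partialComp_le _ _ _ _ (measurableSet_crossing J a t) (fun x hx => ?_) g
    obtain ⟨n, hn⟩ := mem_iUnion.1 hx
    obtain ⟨hnJ, -, hlt, hle, -⟩ := (ha.mem_I_iff ht).1 hn
    rw [reflect, ha.blockIndex_eq ht hn]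
    exact mem_crossing.2 ⟨n, hnJ, by linarith, by linarith⟩
  · simp

theorem IsLacunarySeq.eventually_notMem_crossing (ha : IsLacunarySeq J a) {x : ℝ} (hx : 0 < x) :
    ∀ᶠ t in 𝓝 0, x ∉ crossing J a t := by
  suffices ∃ ε > 0, ∀ n ∈ J, x < a n → x + ε ≤ a n by
    obtain ⟨ε, hε, hgap⟩ := this
    filter_upwards [gt_mem_nhds hε] with t ht hmem
    obtain ⟨n, hn, hle, hlt⟩ := mem_crossing.1 hmem
    linarith [hgap n hn hlt]
  by_cases h : ∃ m ∈ J, x < a m ∧ a m ≤ 2 * x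
  · obtain ⟨m, hm, hlt, hle⟩ := h
    refine ⟨a m - x, sub_pos.2 hlt, fun n hn hxn => ?_⟩
    rcases lt_or_ge n m with hnm | hnm
    · linarith [ha.two_mul_le_of_lt hn hm hnm]
    · rcases hnm.eq_or_lt with rfl | hmn
      · linarith
      · linarith [ha.lt_of_lt hm hn hmn]
  · push Not at h
    exact ⟨x, hx, fun n hn hxn => by linarith [h n hn hxn]⟩

theorem tendsto_eLpNorm_restrict_of_eventually_notMem {α E ι : Type*} {m : MeasurableSpace α}
    {μ : Measure α} [NormedAddCommGroup E] {p : ENNReal} (hp0 : p ≠ 0) (hp : p ≠ ⊤) {f : α → E}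
    (hf : MemLp f p μ) {l : Filter ι} [l.IsCountablyGenerated] {S : ι → Set α}
    (hS : ∀ i, MeasurableSet (S i)) (hlim : ∀ᵐ x ∂μ, ∀ᶠ i in l, x ∉ S i) :
    Tendsto (fun i => eLpNorm f p (μ.restrict (S i))) l (𝓝 0) := by
  set ν : Measure α := μ.withDensity fun x => ‖f x‖ₑ ^ p.toReal with hν
  have : IsFiniteMeasure ν := isFiniteMeasure_withDensity
    (lintegral_rpow_enorm_lt_top_of_eLpNorm_lt_top hp0 hp hf.eLpNorm_lt_top).ne
  have hνS : Tendsto (fun i => ν (S i)) l (𝓝 (ν ∅)) := by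
    refine tendsto_measure_of_ae_tendsto_indicator_of_isFiniteMeasure l .empty hS ?_
    filter_upwards [(withDensity_absolutelyContinuous μ _).ae_le hlim] with x hx
    filter_upwards [hx] with i hi
    simp only [hi, mem_empty_iff_false]
  have hpos : 0 < 1 / p.toReal := one_div_pos.2 (ENNReal.toReal_pos hp0 hp)
  have hroot := hνS.ennrpow_const (1 / p.toReal)
  rw [measure_empty, ENNReal.zero_rpow_of_pos hpos] at hroot
  refine hroot.congr fun i => ?_
  rw [eLpNorm_eq_lintegral_rpow_enorm_toReal hp0 hp, hν, withDensity_apply _ (hS i)]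

theorem tendsto_V (ha : IsLacunarySeq J a) (g : L2) :
    Tendsto (fun t => V J a ha t g) (𝓝[>] 0) (𝓝 0) := by
  rw [tendsto_zero_iff_enorm_tendsto_zero]
  refine tendsto_of_tendsto_of_tendsto_of_le_of_le tendsto_const_nhds ?_ (fun _ => zero_le)
    (enorm_V_le ha · g)
  refine tendsto_eLpNorm_restrict_of_eventually_notMem (by simp) (by simp) (Lp.memLp g)
    (measurableSet_crossing J a) (ae_halfLine_iff.2 ?_)
  filter_upwards [Measure.ae_ne volume 0] with x hx h0
  exact (ha.eventually_notMem_crossing (h0.lt_of_ne' hx)).filter_mono nhdsWithin_le_nhds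

end Crossing

/-! ### Block triangular semigroups -/

theorem IsC0Semigroup.map_natCast_mul {H : Type*} [NormedAddCommGroup H] [InnerProductSpace ℂ H]
    {S : ℝ → H →L[ℂ] H} (hS : IsC0Semigroup S) {t : ℝ} (ht : 0 ≤ t) (n : ℕ) :
    S (n * t) = S t ^ n := by
  induction n with
  | zero => rw [Nat.cast_zero, zero_mul, hS.map_zero, pow_zero, ContinuousLinearMap.one_def]
  | succ n ih =>
    rw [Nat.cast_succ, add_one_mul, hS.map_add _ _ (by positivity) ht, ih, pow_succ]
    rfl

theorem IsC0Semigroup.conjBy {H : Type*} [NormedAddCommGroup H] [InnerProductSpace ℂ H]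
    {S : ℝ → H →L[ℂ] H} (hS : IsC0Semigroup S) (R : H ≃L[ℂ] H) :
    IsC0Semigroup fun t => conjBy R (S t) where
  map_zero := by
    ext1 h
    simp [PackelSemigroup.conjBy, hS.map_zero]
  map_add s t hs ht := by
    ext1 h
    simp [PackelSemigroup.conjBy, hS.map_add s t hs ht]
  tendsto_zero h := by
    have hlim := (R.continuous.tendsto _).comp (hS.tendsto_zero (R.symm h))
    rwa [R.apply_symm_apply] at hlim

theorem isC0Semigroup_leftShift : IsC0Semigroup leftShift where
  map_zero := shift_zero
  map_add _ _ hs _ := leftShift_add hs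
  tendsto_zero f := ((continuous_shift_apply f).tendsto' 0 f
    (by rw [shift_zero, ContinuousLinearMap.id_apply])).mono_left nhdsWithin_le_nhds

theorem isC0Semigroup_rightShift : IsC0Semigroup rightShift where
  map_zero := by rw [rightShift, neg_zero, shift_zero]
  map_add _ _ _ ht := rightShift_add ht
  tendsto_zero f := (((continuous_shift_apply f).comp continuous_neg).tendsto' 0 f
    (by simp [shift_zero])).mono_left nhdsWithin_le_nhds

section UpperBlock

variable {E F : Type*} [NormedAddCommGroup E] [InnerProductSpace ℂ E] [NormedAddCommGroup F]
  [InnerProductSpace ℂ F]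

/-- The operator on the Hilbert direct sum `E ⊕ F` with block matrix rows `(A, B)` and `(0, D)`. -/
def upperBlock (A : E →L[ℂ] E) (B : F →L[ℂ] E) (D : F →L[ℂ] F) :
    WithLp 2 (E × F) →L[ℂ] WithLp 2 (E × F) :=
  ((WithLp.prodContinuousLinearEquiv 2 ℂ E F).symm : E × F →L[ℂ] WithLp 2 (E × F)) ∘L
    ((A.coprod B).prod (D ∘L ContinuousLinearMap.snd ℂ E F)) ∘L
    (WithLp.prodContinuousLinearEquiv 2 ℂ E F : WithLp 2 (E × F) →L[ℂ] E × F)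

theorem upperBlock_apply (A : E →L[ℂ] E) (B : F →L[ℂ] E) (D : F →L[ℂ] F) (h : WithLp 2 (E × F)) :
    upperBlock A B D h = WithLp.toLp 2 (A h.fst + B h.snd, D h.snd) :=
  rfl

variable (E F) in
/-- The embedding of the first summand into the Hilbert direct sum `E ⊕ F`. -/
def inlIsometry : E →ₗᵢ[ℂ] WithLp 2 (E × F) where
  toLinearMap := (WithLp.linearEquiv 2 ℂ (E × F)).symm.toLinearMap ∘ₗ LinearMap.inl ℂ E F
  norm_map' f := by simp

variable (E F) in
/-- The embedding of the second summand into the Hilbert direct sum `E ⊕ F`. -/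
def inrIsometry : F →ₗᵢ[ℂ] WithLp 2 (E × F) where
  toLinearMap := (WithLp.linearEquiv 2 ℂ (E × F)).symm.toLinearMap ∘ₗ LinearMap.inr ℂ E F
  norm_map' g := by simp

theorem upperBlock_inlIsometry (A : E →L[ℂ] E) (B : F →L[ℂ] E) (D : F →L[ℂ] F) (f : E) :
    upperBlock A B D (inlIsometry E F f) = inlIsometry E F (A f) := by
  simp [upperBlock_apply, inlIsometry]

theorem upperBlock_inrIsometry (A : E →L[ℂ] E) (B : F →L[ℂ] E) (D : F →L[ℂ] F) (g : F) :
    upperBlock A B D (inrIsometry E F g) = inlIsometry E F (B g) + inrIsometry E F (D g) := by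
  simp [upperBlock_apply, inlIsometry, inrIsometry, ← WithLp.toLp_add]

theorem upperBlock_comp (A A' : E →L[ℂ] E) (B B' : F →L[ℂ] E) (D D' : F →L[ℂ] F) :
    upperBlock A B D ∘L upperBlock A' B' D' =
      upperBlock (A ∘L A') (A ∘L B' + B ∘L D') (D ∘L D') := by
  ext1 h
  simp [upperBlock_apply, add_assoc]

theorem upperBlock_id : upperBlock (.id ℂ E) 0 (.id ℂ F) = .id ℂ (WithLp 2 (E × F)) := by
  ext1 h
  simp only [upperBlock_apply, ContinuousLinearMap.id_apply, zero_apply, add_zero]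
  rfl

theorem isC0Semigroup_upperBlock {A : ℝ → E →L[ℂ] E} {B : ℝ → F →L[ℂ] E} {D : ℝ → F →L[ℂ] F}
    (hA : IsC0Semigroup A) (hD : IsC0Semigroup D) (hB0 : B 0 = 0)
    (hB_add : ∀ s t, 0 ≤ s → 0 ≤ t → B (s + t) = A s ∘L B t + B s ∘L D t)
    (hB : ∀ g, Tendsto (fun t => B t g) (𝓝[>] 0) (𝓝 0)) :
    IsC0Semigroup fun t => upperBlock (A t) (B t) (D t) where
  map_zero := by rw [hA.map_zero, hB0, hD.map_zero, upperBlock_id]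
  map_add s t hs ht := by
    rw [hA.map_add s t hs ht, hD.map_add s t hs ht, hB_add s t hs ht, upperBlock_comp]
  tendsto_zero h := by
    have hlim := ((hA.tendsto_zero h.fst).add (hB h.snd)).prodMk_nhds (hD.tendsto_zero h.snd)
    have hcont := (WithLp.prodContinuousLinearEquiv 2 ℂ E F).symm.continuous
    rw [add_zero] at hlim
    exact (hcont.tendsto _).comp hlim

theorem norm_upperBlock_zero_le {A : E →L[ℂ] E} {D : F →L[ℂ] F} (hA : ‖A‖ ≤ 1) (hD : ‖D‖ ≤ 1) :
    ‖upperBlock A 0 D‖ ≤ 1 := by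
  refine ContinuousLinearMap.opNorm_le_bound _ zero_le_one fun h => ?_
  rw [one_mul, ← sq_le_sq₀ (norm_nonneg _) (norm_nonneg _), WithLp.prod_norm_sq_eq_of_L2,
    WithLp.prod_norm_sq_eq_of_L2]
  have hfst := A.le_of_opNorm_le hA h.fst
  have hsnd := D.le_of_opNorm_le hD h.snd
  rw [one_mul] at hfst hsnd
  simp only [upperBlock_apply, zero_apply, add_zero]
  gcongr
  exacts [hfst, hsnd]

/-- Conjugation by the shear with entry `Z` subtracts `A Z - Z D` from the off-diagonal entry. -/
theorem isSimilarToContraction_upperBlock {A : E →L[ℂ] E} {Z : F →L[ℂ] E} {D : F →L[ℂ] F}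
    (hA : ‖A‖ ≤ 1) (hD : ‖D‖ ≤ 1) :
    IsSimilarToContraction (upperBlock A (A ∘L Z - Z ∘L D) D) := by
  have hshear : ∀ Z' : F →L[ℂ] E, Function.LeftInverse (upperBlock (.id ℂ E) (-Z') (.id ℂ F))
      (upperBlock (.id ℂ E) Z' (.id ℂ F)) := fun Z' h => by
    simp only [upperBlock_apply, ContinuousLinearMap.id_apply, neg_apply, WithLp.toLp_fst,
      WithLp.toLp_snd, add_neg_cancel_right]
    rfl
  have hshear' := hshear (-Z)
  rw [neg_neg] at hshear'
  refine ⟨.equivOfInverse _ _ (hshear Z) hshear', ?_⟩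
  have hconj : upperBlock (.id ℂ E) Z (.id ℂ F) ∘L upperBlock A (A ∘L Z - Z ∘L D) D ∘L
      upperBlock (.id ℂ E) (-Z) (.id ℂ F) = upperBlock A 0 D := by
    rw [upperBlock_comp, upperBlock_comp]
    congr 1
    ext1 g
    simp only [ContinuousLinearMap.comp_apply, ContinuousLinearMap.id_apply, add_apply, sub_apply,
      neg_apply, zero_apply, map_neg]
    abel
  exact (congrArg norm hconj).trans_le (norm_upperBlock_zero_le hA hD)

end UpperBlock

section PackelT

variable {J : Set ℤ} {a : ℤ → ℝ}

theorem T_eq_upperBlock (ha : IsLacunarySeq J a) (t : ℝ) :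
    T J a ha t = upperBlock (leftShift t) (V J a ha t) (rightShift t) :=
  rfl

theorem isC0Semigroup_T (ha : IsLacunarySeq J a) : IsC0Semigroup (T J a ha) :=
  isC0Semigroup_upperBlock isC0Semigroup_leftShift isC0Semigroup_rightShift
    (dif_neg (lt_irrefl 0)) (fun _ _ => V_add ha) (tendsto_V ha)

theorem mul_sum_sub_sum_mul {A : Type*} [Ring A] {l r : A} (hlr : l * r = 1) (v : A) (N : ℕ) :
    l * ∑ k ∈ Finset.range N, r ^ (k + 1) * v * r ^ k -
      (∑ k ∈ Finset.range N, r ^ (k + 1) * v * r ^ k) * r = v - r ^ N * v * r ^ N := by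
  have hterm : ∀ k, l * (r ^ (k + 1) * v * r ^ k) - r ^ (k + 1) * v * r ^ k * r =
      r ^ k * v * r ^ k - r ^ (k + 1) * v * r ^ (k + 1) := fun k => by
    rw [pow_succ' r k, ← mul_assoc l, ← mul_assoc l, ← mul_assoc l, hlr, one_mul, mul_assoc _ _ r,
      ← pow_succ, pow_succ' r k]
  rw [Finset.mul_sum, Finset.sum_mul, ← Finset.sum_sub_distrib, Finset.sum_congr rfl fun k _ =>
    hterm k, Finset.sum_range_sub', pow_zero, one_mul, mul_one]

theorem V_comp_rightShift_eq_zero (ha : IsLacunarySeq J a) {s : ℝ} (hs : ∀ n ∈ J, a n ≤ s)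
    (hs0 : 0 ≤ s) (t : ℝ) : V J a ha t ∘L rightShift s = 0 := by
  ext1 g
  rw [ContinuousLinearMap.comp_apply, zero_apply, ← enorm_eq_zero,
    ← nonpos_iff_eq_zero]
  refine (enorm_V_le ha t _).trans_eq ?_
  rw [eLpNorm_congr_ae (g := 0), eLpNorm_zero]
  refine (ae_restrict_iff' (measurableSet_crossing J a t)).2 (ae_halfLine_iff.2 ?_)
  filter_upwards [zeroExt_rightShift hs0 g] with x hx h0 hmem
  obtain ⟨n, hn, -, hlt⟩ := mem_crossing.1 hmem
  rw [← zeroExt_of_nonneg _ h0, hx, zeroExt_of_neg _ (by linarith [hs n hn]), Pi.zero_apply]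

/-- Since `V(t) R(t)^N = 0` for large `N`, the equation `V = L Z - Z R` is solved by the finite sum
`Z = ∑ R^(k+1) V R^k`. -/
theorem isSimilarToContraction_T (ha : IsLacunarySeq J a) {B : ℝ} (hB : ∀ n ∈ J, a n ≤ B) {t : ℝ}
    (ht : 0 < t) : IsSimilarToContraction (T J a ha t) := by
  obtain ⟨N, hN⟩ := exists_nat_ge (B / t)
  rw [div_le_iff₀ ht] at hN
  have hVR : V J a ha t * rightShift t ^ N = 0 := by
    rw [← isC0Semigroup_rightShift.map_natCast_mul ht.le]
    exact V_comp_rightShift_eq_zero ha (fun n hn => (hB n hn).trans hN) (by positivity) t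
  have hZ := mul_sum_sub_sum_mul (leftShift_comp_rightShift ht.le) (V J a ha t) N
  rw [mul_assoc (rightShift t ^ N), hVR, mul_zero, sub_zero] at hZ
  rw [T_eq_upperBlock, ← hZ]
  exact isSimilarToContraction_upperBlock (norm_shift_le_one t) (norm_shift_le_one (-t))

end PackelT

/-! ### Bump functions -/

section Bump

theorem halfLine_Ioo_ne_top (p q : ℝ) : halfLine (Ioo p q) ≠ ⊤ :=
  ((Measure.restrict_apply_le _ _).trans_lt measure_Ioo_lt_top).ne

/-- The indicator function of `(p, p + δ)`, normalized in `L²`. The translates and reflections of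
such functions are the test vectors of the obstruction. -/
def bump (δ p : ℝ) : L2 :=
  indicatorConstLp 2 (measurableSet_Ioo : MeasurableSet (Ioo p (p + δ)))
    (halfLine_Ioo_ne_top _ _) (((√δ)⁻¹ : ℝ) : ℂ)

variable {δ p q : ℝ}

theorem zeroExt_bump (δ : ℝ) (hp : 0 ≤ p) : ∀ᵐ x, zeroExt (bump δ p) x =
    (Ioo p (p + δ)).indicator (fun _ => (((√δ)⁻¹ : ℝ) : ℂ)) x := by
  filter_upwards [ae_halfLine_iff.1 (indicatorConstLp_coeFn (p := 2)
    (hs := (measurableSet_Ioo : MeasurableSet (Ioo p (p + δ))))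
    (hμs := halfLine_Ioo_ne_top _ _) (c := (((√δ)⁻¹ : ℝ) : ℂ)))] with x hx
  rcases le_or_gt 0 x with h0 | h0
  · rw [zeroExt_of_nonneg _ h0]
    exact hx h0
  · rw [zeroExt_of_neg _ h0, indicator_of_notMem fun hmem => (hp.trans_lt hmem.1).not_gt h0]

theorem inner_bump_bump (hδ : 0 ≤ δ) (hp : 0 ≤ p) :
    inner ℂ (bump δ p) (bump δ q) = ((max (δ - |p - q|) 0 / δ : ℝ) : ℂ) := by
  have hvol : halfLine.real (Ioo p (p + δ) ∩ Ioo q (q + δ)) = max (δ - |p - q|) 0 := by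
    rw [Ioo_inter_Ioo, halfLine, measureReal_restrict_apply measurableSet_Ioo, inter_eq_left.2,
      measureReal_def, Real.volume_Ioo, ENNReal.toReal_ofReal', min_add_add_right,
      ← max_sub_min_eq_abs']
    · congr 1
      ring
    · exact fun x hx => (hp.trans (le_max_left p q)).trans hx.1.le
  rw [bump, bump, L2.inner_indicatorConstLp_indicatorConstLp measurableSet_Ioo measurableSet_Ioo
    (halfLine_Ioo_ne_top _ _) (halfLine_Ioo_ne_top _ _), hvol, RCLike.inner_apply,
    Complex.conj_ofReal, ← Complex.ofReal_mul, ← mul_inv, Real.mul_self_sqrt hδ,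
    Complex.real_smul, ← Complex.ofReal_mul, div_eq_mul_inv]

theorem norm_bump (hδ : 0 < δ) (hp : 0 ≤ p) : ‖bump δ p‖ = 1 := by
  rw [← pow_eq_one_iff_of_nonneg (norm_nonneg _) two_ne_zero, ← inner_self_eq_norm_sq (𝕜 := ℂ),
    inner_bump_bump hδ.le hp, RCLike.re_to_complex, Complex.ofReal_re, sub_self, abs_zero, sub_zero,
    max_eq_left hδ.le, div_self hδ.ne']

theorem inner_bump_eq_zero (hδ : 0 ≤ δ) (hp : 0 ≤ p) (hpq : δ ≤ |p - q|) :
    inner ℂ (bump δ p) (bump δ q) = 0 := by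
  rw [inner_bump_bump hδ hp, max_eq_right (by linarith), zero_div, Complex.ofReal_zero]

theorem norm_bump_sub_sq_le (hδ : 0 < δ) (hp : 0 ≤ p) (hq : 0 ≤ q) :
    ‖bump δ p - bump δ q‖ ^ 2 ≤ 2 * |p - q| / δ := by
  rw [norm_sub_sq (𝕜 := ℂ), norm_bump hδ hp, norm_bump hδ hq, inner_bump_bump hδ.le hp,
    RCLike.re_to_complex, Complex.ofReal_re]
  have hle : (δ - |p - q|) / δ ≤ max (δ - |p - q|) 0 / δ := by
    gcongr
    exact le_max_left _ _
  rw [sub_div, div_self hδ.ne'] at hle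
  rw [mul_div_assoc]
  linarith

theorem orthonormal_bump {ι : Type*} {x : ι → ℝ} (hδ : 0 < δ) (hx : ∀ i, 0 ≤ x i)
    (hgap : ∀ i j, i ≠ j → δ ≤ |x i - x j|) : Orthonormal ℂ fun i => bump δ (x i) :=
  ⟨fun i => norm_bump hδ (hx i), fun i j hij =>
    inner_bump_eq_zero hδ.le (hx i) (hgap i j hij)⟩

theorem shift_bump {s : ℝ} (δ : ℝ) (hp : 0 ≤ p) (hps : 0 ≤ p - s) :
    shift s (bump δ p) = bump δ (p - s) := by
  refine ext_zeroExt ?_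
  filter_upwards [zeroExt_shift s (bump δ p), ae_comp_add (zeroExt_bump δ hp) s,
    zeroExt_bump δ hps] with x hshift hx hxs h0
  rw [hshift h0, hx, hxs]
  refine indicator_eq_indicator ?_ rfl
  rw [mem_Ioo, mem_Ioo, sub_lt_iff_lt_add, sub_add_eq_add_sub, lt_sub_iff_add_lt]

end Bump

section ReflectedBump

variable {J : Set ℤ} {a : ℤ → ℝ} {δ x y s : ℝ} {k : ℤ}

theorem IsLacunarySeq.mem_crossed_and_mem_Ioo_iff (ha : IsLacunarySeq J a) (hk : k ∈ J)
    (hx : 0 ≤ x) (hs : x + y + s + δ = 2 * a k) (hxk : x + δ ≤ a k) (hyk : y + δ ≤ a k)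
    {z : ℝ} (hz : 0 ≤ z) {n : ℤ} : n ∈ crossed J a z s ∧ 2 * a n - z - s ∈ Ioo y (y + δ) ↔
      n = k ∧ z ∈ Ioo x (x + δ) := by
  rw [crossed, mem_ofPred_eq, mem_Ico, mem_Ioo, mem_Ioo]
  constructor
  · rintro ⟨⟨hn, hle, _⟩, hlt, hlt'⟩
    rcases lt_trichotomy n k with hnk | rfl | hnk
    · linarith [ha.two_mul_le_of_lt hn hk hnk]
    · exact ⟨rfl, by linarith, by linarith⟩
    · linarith [ha.two_mul_le_of_lt hk hn hnk]
  · rintro ⟨rfl, hlt, hlt'⟩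
    exact ⟨⟨hk, by linarith, by linarith⟩, by linarith, by linarith⟩

/-- The bump moves to the right from `y`, is reflected at `a_k`, and reaches `x` at time `s`; no
other node reflects it into `ℝ₊`. -/
theorem V_bump (ha : IsLacunarySeq J a) (hk : k ∈ J) (hx : 0 ≤ x) (hy : 0 ≤ y)
    (hs : x + y + s + δ = 2 * a k) (hxk : x + δ ≤ a k) (hyk : y + δ ≤ a k) :
    V J a ha s (bump δ y) = bump δ x := by
  refine ext_zeroExt ?_
  have hreflect : ∀ᵐ z, ∀ n : ℤ, zeroExt (bump δ y) (2 * a n - z - s) =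
      (Ioo y (y + δ)).indicator (fun _ => (((√δ)⁻¹ : ℝ) : ℂ)) (2 * a n - z - s) := by
    refine ae_all_iff.2 fun n => ?_
    filter_upwards [ae_comp_sub_left (zeroExt_bump δ hy) (2 * a n - s)] with z hz
    rwa [sub_right_comm] at hz
  filter_upwards [zeroExt_V ha s (bump δ y), hreflect, zeroExt_bump δ hx] with z hV hz hzx h0
  have hmem {n : ℤ} := ha.mem_crossed_and_mem_Ioo_iff hk hx hs hxk hyk h0 (n := n)
  rw [hV h0, hzx, finsum_mem_def, finsum_eq_single _ k fun n hn => ?_]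
  · by_cases hzk : z ∈ Ioo x (x + δ)
    · obtain ⟨hcrossed, hIoo⟩ := hmem.2 ⟨rfl, hzk⟩
      rw [indicator_of_mem hcrossed, hz, indicator_of_mem hIoo, indicator_of_mem hzk]
    · rw [indicator_of_notMem hzk, indicator_apply_eq_zero]
      intro hcrossed
      rw [hz, indicator_of_notMem fun hIoo => hzk (hmem.1 ⟨hcrossed, hIoo⟩).2]
  · rw [indicator_apply_eq_zero]
    intro hcrossed
    rw [hz, indicator_of_notMem fun hIoo => hn (hmem.1 ⟨hcrossed, hIoo⟩).1]

end ReflectedBump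

/-! ### Obstruction to similarity -/

section GridFloor

variable {t x y : ℝ}

/-- The largest multiple of the step `t` below `x`, for `0 ≤ x`. -/
def gridFloor (t x : ℝ) : ℝ := ⌊x / t⌋₊ * t

theorem gridFloor_nonneg (ht : 0 ≤ t) (x : ℝ) : 0 ≤ gridFloor t x :=
  mul_nonneg (Nat.cast_nonneg _) ht

theorem gridFloor_le (ht : 0 < t) (hx : 0 ≤ x) : gridFloor t x ≤ x :=
  (le_div_iff₀ ht).1 (Nat.floor_le (div_nonneg hx ht.le))

theorem lt_gridFloor_add (ht : 0 < t) (x : ℝ) : x < gridFloor t x + t := by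
  rw [gridFloor, ← add_one_mul, ← div_lt_iff₀ ht]
  exact Nat.lt_floor_add_one _

theorem exists_natCast_mul_eq_gridFloor_sub (ht : 0 ≤ t) (hxy : x ≤ y) :
    ∃ n : ℕ, n * t = gridFloor t y - gridFloor t x := by
  refine ⟨⌊y / t⌋₊ - ⌊x / t⌋₊, ?_⟩
  rw [Nat.cast_sub (Nat.floor_mono (div_le_div_of_nonneg_right hxy ht)), sub_mul, gridFloor,
    gridFloor]

end GridFloor

section Obstruction

variable {J : Set ℤ} {a : ℤ → ℝ} {δ x y s t : ℝ} {m j k : ℤ}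

theorem T_inl_bump (ha : IsLacunarySeq J a) (δ : ℝ) (hx : 0 ≤ x) (hxs : 0 ≤ x - s) :
    T J a ha s (inlIsometry L2 L2 (bump δ x)) = inlIsometry L2 L2 (bump δ (x - s)) := by
  rw [T_eq_upperBlock, upperBlock_inlIsometry, leftShift, shift_bump δ hx hxs]

theorem T_smul_inl_add_inr_bump (ha : IsLacunarySeq J a) (hk : k ∈ J) (hδ : 0 ≤ δ) (hx : 0 ≤ x)
    (hy : 0 ≤ y) (hs : x + y + s + δ = 2 * a k) (hxk : x + δ ≤ a k) (hyk : y + δ ≤ a k) (μ : ℝ) :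
    T J a ha s ((μ : ℂ) • inlIsometry L2 L2 (bump δ (x + s)) + inrIsometry L2 L2 (bump δ y)) =
      ((1 + μ : ℝ) : ℂ) • inlIsometry L2 L2 (bump δ x) + inrIsometry L2 L2 (bump δ (y + s)) := by
  rw [map_add, map_smul, T_inl_bump ha δ (by linarith) (by linarith), add_sub_cancel_right,
    T_eq_upperBlock, upperBlock_inrIsometry, V_bump ha hk hx hy hs hxk hyk, rightShift,
    shift_bump δ hy (by linarith), sub_neg_eq_add, Complex.ofReal_add, Complex.ofReal_one, add_smul,
    one_smul]
  abel

variable {H : Type*} [NormedAddCommGroup H] [InnerProductSpace ℂ H] {U : L2Sum →L[ℂ] H}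
  {c K B ε : ℝ}

section LinearIsometry

variable {F : Type*} [NormedAddCommGroup F] [InnerProductSpace ℂ F] {L : F →L[ℂ] H}

theorem norm_apply_bump_le (hL : ‖L‖ ≤ K) (i : L2 →ₗᵢ[ℂ] F) (hδ : 0 < δ) (hx : 0 ≤ x) :
    ‖L (i (bump δ x))‖ ≤ K := by
  simpa [norm_bump hδ hx] using L.le_of_opNorm_le hL (i (bump δ x))

theorem norm_apply_bump_sub_le (hL : ‖L‖ ≤ K) (i : L2 →ₗᵢ[ℂ] F) (hδ : 0 < δ) (hx : 0 ≤ x)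
    (hxt : x ≤ t) (hy : 0 ≤ y) (hyt : y ≤ t) :
    ‖L (i (bump δ x)) - L (i (bump δ y))‖ ≤ K * √(2 * t / δ) := by
  rw [← map_sub, ← map_sub]
  refine (L.le_of_opNorm_le hL _).trans ?_
  rw [i.norm_map]
  gcongr
  · exact (norm_nonneg L).trans hL
  · refine Real.le_sqrt_of_sq_le ((norm_bump_sub_sq_le hδ hx hy).trans ?_)
    gcongr
    exact abs_sub_le_iff.2 ⟨by linarith, by linarith⟩

theorem isBesselFamily_bump [CompleteSpace F] [CompleteSpace H] (hL : ‖L‖ ≤ K)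
    (i : L2 →ₗᵢ[ℂ] F) (hδ : 0 < δ) {S : Finset ℕ} {x : ℕ → ℝ} (hx : ∀ k ∈ S, 0 ≤ x k)
    (hgap : ∀ k ∈ S, ∀ l ∈ S, k < l → x k + δ ≤ x l) :
    IsBesselFamily ℂ (K ^ 2) S fun k => L (i (bump δ (x k))) := by
  have horth : Orthonormal ℂ fun k : S => bump δ (x k) :=
    orthonormal_bump hδ (fun k => hx k k.2) fun k l hkl => by
      rw [le_abs]
      rcases lt_or_gt_of_ne (Subtype.coe_ne_coe.2 hkl) with hlt | hlt
      · exact .inr (by linarith [hgap k k.2 l l.2 hlt])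
      · exact .inl (by linarith [hgap l l.2 k k.2 hlt])
  exact .of_orthonormal (e := fun k => i (bump δ (x k))) (horth.comp_linearIsometry i) L hL

theorem isBesselFamily_bump_gridFloor [CompleteSpace F] [CompleteSpace H] {N : ℕ} (hL : ‖L‖ ≤ K)
    (i : L2 →ₗᵢ[ℂ] F) (ha : IsLacunarySeq J a) (hm : ∀ k : ℕ, k ≤ N → m + k ∈ J) (ht : 0 < t)
    (htδ : t ≤ δ) (hδ : ∀ k : ℕ, k ≤ N → δ ≤ a (m + k)) :
    IsBesselFamily ℂ (K ^ 2) (Finset.Iic N)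
      fun k => L (i (bump δ (gridFloor t (2 * a (m + k) - δ)))) := by
  refine isBesselFamily_bump hL i (ht.trans_le htδ) (fun k _ => gridFloor_nonneg ht.le _)
    fun j _ k hk hjk => ?_
  rw [Finset.mem_Iic] at hk
  have hδj := hδ j (by omega)
  have hlac := ha.two_mul_le_of_lt (hm j (by omega)) (hm k hk) (by omega)
  have hfloor := gridFloor_le (x := 2 * a (m + j) - δ) ht (by linarith)
  linarith [lt_gridFloor_add ht (2 * a (m + k) - δ)]

theorem isBesselFamily_bump_reflect [CompleteSpace F] [CompleteSpace H] {N j : ℕ} (hL : ‖L‖ ≤ K)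
    (i : L2 →ₗᵢ[ℂ] F) (ha : IsLacunarySeq J a) (hm : ∀ k : ℕ, k ≤ N → m + k ∈ J) (hδ0 : 0 < δ)
    (hδ : ∀ k : ℕ, k ≤ N → δ ≤ a (m + k)) (hj : j ≤ N) (hx : x ≤ a (m + j)) :
    IsBesselFamily ℂ (K ^ 2) (Finset.Ioc j N) fun k => L (i (bump δ (2 * a (m + k) - δ - x))) := by
  refine isBesselFamily_bump hL i hδ0 (fun k hk => ?_) fun k hk l hl hkl => ?_
  all_goals simp only [Finset.mem_Ioc] at *
  · linarith [ha.two_mul_le_of_lt (hm j hj) (hm k hk.2) (by omega), hδ j hj]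
  · linarith [ha.two_mul_le_of_lt (hm k hk.2) (hm l hl.2) (by omega), hδ k hk.2]

end LinearIsometry

theorem norm_apply_gridFloor_le (ha : IsLacunarySeq J a) (hj : j ∈ J) (hk : k ∈ J) (hjk : j < k)
    (ht : 0 < t) (hδ : 0 ≤ δ) (hkB : a k ≤ B)
    (hU : ∀ n : ℕ, n * t ≤ B → ∀ h, ‖U (T J a ha (n * t) h)‖ ^ 2 ≤ (1 + ε) * ‖U h‖ ^ 2) :
    ‖U (inlIsometry L2 L2 (bump δ (gridFloor t (2 * a j - δ))))‖ ^ 2 ≤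
      (1 + ε) * ‖U (inlIsometry L2 L2 (bump δ (gridFloor t (a k))))‖ ^ 2 := by
  have hle : 2 * a j - δ ≤ a k := by linarith [ha.two_mul_le_of_lt hj hk hjk]
  have hnonneg := gridFloor_nonneg ht.le
  obtain ⟨n, hn⟩ := exists_natCast_mul_eq_gridFloor_sub ht.le hle
  have hn_le : n * t ≤ B := by
    linarith [gridFloor_le ht (ha.pos k hk).le, hnonneg (2 * a j - δ)]
  have hUn := hU n hn_le (inlIsometry L2 L2 (bump δ (gridFloor t (a k))))
  rwa [hn, T_inl_bump ha δ (hnonneg _) (by linarith [hnonneg (2 * a j - δ)]), sub_sub_cancel]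
    at hUn

theorem norm_reflect_gridFloor_le (ha : IsLacunarySeq J a) (hj : j ∈ J) (hk : k ∈ J) (hjk : j < k)
    (ht : 0 < t) (htδ : t ≤ δ) (hδj : δ ≤ a j) (hkB : 2 * a k ≤ B)
    (hU : ∀ n : ℕ, n * t ≤ B → ∀ h, ‖U (T J a ha (n * t) h)‖ ^ 2 ≤ (1 + ε) * ‖U h‖ ^ 2)
    (μ : ℝ) :
    ‖((1 + μ : ℝ) : ℂ) • U (inlIsometry L2 L2 (bump δ (gridFloor t (a j)))) +
        U (inrIsometry L2 L2 (bump δ (2 * a k - δ - gridFloor t (a j))))‖ ^ 2 ≤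
      (1 + ε) * ‖(μ : ℂ) • U (inlIsometry L2 L2 (bump δ (gridFloor t (2 * a k - δ)))) +
        U (inrIsometry L2 L2 (bump δ (2 * a k - δ - gridFloor t (2 * a k - δ))))‖ ^ 2 := by
  have hlac := ha.two_mul_le_of_lt hj hk hjk
  have hj_le : gridFloor t (a j) ≤ a j := gridFloor_le ht (ha.pos j hj).le
  have hk_le : gridFloor t (2 * a k - δ) ≤ 2 * a k - δ := gridFloor_le ht (by linarith)
  have hk_lt := lt_gridFloor_add ht (2 * a k - δ)
  obtain ⟨n, hn⟩ := exists_natCast_mul_eq_gridFloor_sub ht.le (show a j ≤ 2 * a k - δ by linarith)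
  have hn_le : n * t ≤ B := by linarith [gridFloor_nonneg ht.le (a j)]
  have hUn := hU n hn_le ((μ : ℂ) • inlIsometry L2 L2 (bump δ (gridFloor t (a j) + n * t)) +
    inrIsometry L2 L2 (bump δ (2 * a k - δ - gridFloor t (2 * a k - δ))))
  rw [T_smul_inl_add_inr_bump ha hk (by linarith) (gridFloor_nonneg ht.le _) (by linarith)
    (by linarith) (by linarith) (by linarith)] at hUn
  rwa [hn, add_sub_cancel, sub_add_sub_cancel, map_add, map_add, map_smul, map_smul] at hUn

theorem reflectionSystem_of_norm_T_le [CompleteSpace H] (ha : IsLacunarySeq J a) {N : ℕ}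
    (hm : ∀ k : ℕ, k ≤ N → m + k ∈ J) (ht : 0 < t) (htδ : t ≤ δ) (hδ : δ ≤ a m)
    (hc : ∀ h, c * ‖h‖ ^ 2 ≤ ‖U h‖ ^ 2) (hK : ‖U‖ ≤ K) (hε : K * √(2 * t / δ) ≤ ε)
    (hU : ∀ n : ℕ, n * t ≤ 2 * a (m + N) → ∀ h,
      ‖U (T J a ha (n * t) h)‖ ^ 2 ≤ (1 + ε) * ‖U h‖ ^ 2) :
    ReflectionSystem ℂ N c K ε
      (fun j => U (inlIsometry L2 L2 (bump δ (gridFloor t (a (m + j))))))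
      (fun k => U (inlIsometry L2 L2 (bump δ (gridFloor t (2 * a (m + k) - δ)))))
      (fun k => U (inrIsometry L2 L2 (bump δ
        (2 * a (m + k) - δ - gridFloor t (2 * a (m + k) - δ)))))
      (fun j k => U (inrIsometry L2 L2 (bump δ
        (2 * a (m + k) - δ - gridFloor t (a (m + j)))))) := by
  have hδ0 : 0 < δ := ht.trans_le htδ
  have hmono : ∀ j k : ℕ, j ≤ k → k ≤ N → a (m + j) ≤ a (m + k) := fun j k hjk hk =>
    ha.le_of_le (hm j (by omega)) (hm k hk) (by omega)
  have hδa : ∀ k : ℕ, k ≤ N → δ ≤ a (m + k) := fun k hk =>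
    (hδ.trans_eq (by simp)).trans (hmono 0 k k.zero_le hk)
  have hfloor : ∀ k : ℕ, k ≤ N → gridFloor t (2 * a (m + k) - δ) ≤ 2 * a (m + k) - δ :=
    fun k hk => gridFloor_le ht (by linarith [hδa k hk])
  have hlt : ∀ k : ℕ, 2 * a (m + k) - δ < gridFloor t (2 * a (m + k) - δ) + t := fun k =>
    lt_gridFloor_add ht _
  have hnonneg := gridFloor_nonneg ht.le
  constructor
  case le_norm_f =>
    intro j _
    simpa [norm_bump hδ0 (hnonneg _)] using
      hc (inlIsometry L2 L2 (bump δ (gridFloor t (a (m + j)))))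
  case norm_f_le => exact fun j _ => norm_apply_bump_le hK _ hδ0 (hnonneg _)
  case norm_e_le => exact fun k _ => norm_apply_bump_le hK _ hδ0 (hnonneg _)
  case norm_g_le => exact fun k hk => norm_apply_bump_le hK _ hδ0 (sub_nonneg.2 (hfloor k hk))
  case bessel_e => exact isBesselFamily_bump_gridFloor hK _ ha hm ht htδ hδa
  case bessel_d =>
    intro j hj
    have hfloor_j := gridFloor_le ht (hδ0.le.trans (hδa j hj))
    exact isBesselFamily_bump_reflect hK _ ha hm hδ0 hδa hj hfloor_j
  case norm_g_sub_le =>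
    exact fun k hk => (norm_apply_bump_sub_le hK _ hδ0 (sub_nonneg.2 (hfloor k hk))
      (by linarith [hlt k]) (sub_nonneg.2 (hfloor 0 N.zero_le)) (by linarith [hlt 0])).trans hε
  case norm_e_le_norm_f =>
    exact fun k l hkl hl => norm_apply_gridFloor_le ha (hm k (by omega)) (hm l hl) (by omega) ht
      hδ0.le (by linarith [hmono l N hl le_rfl, hδa N le_rfl]) hU
  case reflect =>
    exact fun j k hjk hk => norm_reflect_gridFloor_le ha (hm j (by omega)) (hm k hk) (by omega) ht
      htδ (hδa j (by omega)) (by linarith [hmono k N hk le_rfl]) hU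

theorem norm_apply_le_norm_conjBy_mul (R : L2Sum ≃L[ℂ] L2Sum) (A : L2Sum →L[ℂ] L2Sum) (h : L2Sum) :
    ‖R (A h)‖ ≤ ‖conjBy R A‖ * ‖R h‖ := by
  simpa [conjBy] using (conjBy R A).le_opNorm (R h)

theorem exists_lt_norm_conjBy_T (R : L2Sum ≃L[ℂ] L2Sum) :
    ∃ (N : ℕ) (q ε : ℝ), 1 ≤ q ∧ 0 < ε ∧
      ∀ (J : Set ℤ) (a : ℤ → ℝ) (ha : IsLacunarySeq J a) (m : ℤ) (t : ℝ),
        (∀ k : ℕ, k ≤ N → m + k ∈ J) → 0 < t → q * t ≤ a m →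
          ∃ n : ℕ, n * t ≤ 2 * a (m + N) ∧ 1 + ε < ‖conjBy R (T J a ha (n * t))‖ ^ 2 := by
  let U : L2Sum →L[ℂ] L2Sum := R
  let K : ℝ := max 1 ‖U‖
  let C : ℝ := 1 + ‖(R.symm : L2Sum →L[ℂ] L2Sum)‖
  have hK : 1 ≤ K := le_max_left _ _
  have : 0 < C := by positivity
  obtain ⟨N, ε, hε, hno⟩ :=
    exists_not_reflectionSystem (𝕜 := ℂ) (H := L2Sum) (c := (C ^ 2)⁻¹) (by positivity) hK
  have hbelow : ∀ h, (C ^ 2)⁻¹ * ‖h‖ ^ 2 ≤ ‖U h‖ ^ 2 := fun h => by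
    rw [inv_mul_le_iff₀ (by positivity), ← mul_pow]
    gcongr
    simpa [U] using (R.symm : L2Sum →L[ℂ] L2Sum).le_of_opNorm_le (le_add_of_nonneg_left zero_le_one)
      (R h)
  refine ⟨N, 1 + 2 * (K / ε) ^ 2, ε, le_add_of_nonneg_right (by positivity), hε,
    fun J a ha m t hm ht hqt => ?_⟩
  by_contra! hcon
  refine hno _ _ _ _ (reflectionSystem_of_norm_T_le (U := U) ha hm ht
    (le_mul_of_one_le_left ht.le (le_add_of_nonneg_right (by positivity))) hqt hbelow
    (le_max_right _ _) ?_ fun n hn h => ?_)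
  · rw [mul_div_mul_right _ _ ht.ne', ← le_div_iff₀' (by positivity)]
    refine Real.sqrt_le_iff.2 ⟨by positivity, (div_le_iff₀ (by positivity)).2 ?_⟩
    rw [mul_add, mul_left_comm, ← mul_pow, div_mul_div_cancel₀ (by positivity), div_self hε.ne']
    linarith [sq_nonneg (ε / K)]
  · refine (pow_le_pow_left₀ (norm_nonneg _) (norm_apply_le_norm_conjBy_mul R _ h) 2).trans ?_
    rw [mul_pow]
    exact mul_le_mul_of_nonneg_right (hcon n hn) (sq_nonneg _)

theorem not_isSimilarToContraction_T (ha : IsLacunarySeq J a) (hJ : ∀ n : ℤ, 0 ≤ n → n ∈ J)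
    (ht : 0 < t) : ¬ IsSimilarToContraction (T J a ha t) := by
  rintro ⟨R, hR⟩
  obtain ⟨N, q, ε, -, hε, hgrow⟩ := exists_lt_norm_conjBy_T R
  obtain ⟨m, hm0, hm⟩ := ha.exists_gt hJ (q * t)
  obtain ⟨n, -, hn⟩ := hgrow J a ha m t (fun k _ => hJ _ (by omega)) ht hm.le
  have hle : ‖conjBy R (T J a ha (n * t))‖ ≤ 1 := by
    rw [((isC0Semigroup_T ha).conjBy R).map_natCast_mul ht.le]
    rcases n.eq_zero_or_pos with rfl | hn
    · exact ContinuousLinearMap.norm_id_le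
    · exact (norm_pow_le' _ hn).trans (pow_le_one₀ (norm_nonneg _) hR)
  linarith [pow_le_one₀ (n := 2) (norm_nonneg _) hle]

theorem not_isSQC_T (ha : IsLacunarySeq J a) (hJ : ∀ n : ℤ, n ≤ 0 → n ∈ J) :
    ¬ IsSQC (T J a ha) := by
  rintro ⟨-, R, -, ω, hR⟩
  obtain ⟨N, q, ε, hq, hε, hgrow⟩ := exists_lt_norm_conjBy_T R
  have hlog : 0 < Real.log (1 + ε) := Real.log_pos (by linarith)
  obtain ⟨M, hM0, hM⟩ := ha.exists_lt hJ (t := Real.log (1 + ε) / (4 * (|ω| + 1))) (by positivity)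
  rw [lt_div_iff₀ (by positivity)] at hM
  have hq0 : 0 < q := by linarith
  have hpos := ha.pos (M - N) (hJ _ (by omega))
  obtain ⟨n, hn, hlt⟩ := hgrow J a ha (M - N) (a (M - N) / q) (fun k _ => hJ _ (by omega))
    (by positivity) (mul_div_cancel₀ _ hq0.ne').le
  rw [sub_add_cancel] at hn
  have hs : 0 ≤ n * (a (M - N) / q) := by positivity
  refine hlt.not_ge ((pow_le_pow_left₀ (norm_nonneg _) (hR _ hs) 2).trans ?_)
  rw [← Real.exp_nat_mul, ← Real.le_log_iff_exp_le (by linarith)]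
  have hωs : ω * (n * (a (M - N) / q)) ≤ |ω| * (2 * a M) :=
    mul_le_mul (le_abs_self ω) hn hs (abs_nonneg ω)
  push_cast
  linarith [ha.pos M (hJ M hM0)]

end Obstruction

/-! ### Weighted norms -/

section Multiplication

variable {α : Type*} [MeasurableSpace α] {μ : Measure α}

theorem sq_toReal_eLpNorm_two {E : Type*} [NormedAddCommGroup E] {f : α → E} (hf : MemLp f 2 μ) :
    (eLpNorm f 2 μ).toReal ^ 2 = ∫ x, ‖f x‖ ^ 2 ∂μ := by
  rw [hf.eLpNorm_eq_integral_rpow_norm two_ne_zero ENNReal.ofNat_ne_top,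
    ENNReal.toReal_ofReal (by positivity), ENNReal.toReal_ofNat,
    ← Real.rpow_mul_natCast (by positivity)]
  simp

variable {b b' : α → ℂ}

/-- Multiplication by a bounded function on `L²(μ)`. -/
def mulL (hb : MemLp b ⊤ μ) : Lp ℂ 2 μ →L[ℂ] Lp ℂ 2 μ :=
  (ContinuousLinearMap.mul ℂ ℂ).holderL μ ⊤ 2 2 (hb.toLp b)

theorem coeFn_mulL (hb : MemLp b ⊤ μ) (f : Lp ℂ 2 μ) : mulL hb f =ᵐ[μ] fun x => b x * f x := by
  filter_upwards [(ContinuousLinearMap.mul ℂ ℂ).coeFn_holder (r := 2) (hb.toLp b) f,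
    hb.coeFn_toLp] with x hx hbx
  exact hx.trans (by rw [hbx, ContinuousLinearMap.mul_apply'])

theorem mulL_mulL (hb : MemLp b ⊤ μ) (hb' : MemLp b' ⊤ μ) (h : ∀ x, b x * b' x = 1)
    (f : Lp ℂ 2 μ) : mulL hb (mulL hb' f) = f := by
  refine Lp.ext ?_
  filter_upwards [coeFn_mulL hb (mulL hb' f), coeFn_mulL hb' f] with x hx hx'
  rw [hx, hx', ← mul_assoc, h, one_mul]

theorem exists_equiv_norm_sq_eq_integral {u : α → ℝ} {c C : ℝ} (hu : Measurable u) (hc : 0 < c)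
    (hcu : ∀ x, c ≤ u x) (huC : ∀ x, u x ≤ C) :
    ∃ A : Lp ℂ 2 μ ≃L[ℂ] Lp ℂ 2 μ, ∀ f, ‖A f‖ ^ 2 = ∫ x, u x * ‖f x‖ ^ 2 ∂μ := by
  have hsqrt_pos : ∀ x, 0 < √(u x) := fun x => Real.sqrt_pos.2 (hc.trans_le (hcu x))
  have hmeas : Measurable fun x => (√(u x) : ℂ) := by fun_prop
  have hb : MemLp (fun x => (√(u x) : ℂ)) ⊤ μ :=
    memLp_top_of_bound hmeas.aestronglyMeasurable √C (.of_forall fun x => by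
      rw [Complex.norm_of_nonneg (hsqrt_pos x).le]
      exact Real.sqrt_le_sqrt (huC x))
  have hb' : MemLp (fun x => (√(u x) : ℂ)⁻¹) ⊤ μ :=
    memLp_top_of_bound hmeas.inv.aestronglyMeasurable (√c)⁻¹ (.of_forall fun x => by
      rw [norm_inv, Complex.norm_of_nonneg (hsqrt_pos x).le]
      exact inv_anti₀ (Real.sqrt_pos.2 hc) (Real.sqrt_le_sqrt (hcu x)))
  have hne : ∀ x, (√(u x) : ℂ) ≠ 0 := fun x => by exact_mod_cast (hsqrt_pos x).ne'
  refine ⟨.equivOfInverse (mulL hb) (mulL hb')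
    (mulL_mulL hb' hb fun x => inv_mul_cancel₀ (hne x))
    (mulL_mulL hb hb' fun x => mul_inv_cancel₀ (hne x)), fun f => ?_⟩
  rw [ContinuousLinearEquiv.equivOfInverse_apply, Lp.norm_def, sq_toReal_eLpNorm_two (Lp.memLp _)]
  refine integral_congr_ae ?_
  filter_upwards [coeFn_mulL hb f] with x hx
  rw [hx, norm_mul, Complex.norm_of_nonneg (hsqrt_pos x).le, mul_pow,
    Real.sq_sqrt (hc.le.trans (hcu x))]

end Multiplication

section Tent

variable {ω r t ℓ : ℝ}

/-- The function that jumps from `1` to `2` at `0` and then decays back to `1` at rate `ω`. -/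
def tent (ω r : ℝ) : ℝ := if 0 < r then max 1 (2 * Real.exp (-(ω * r))) else 1

theorem tent_of_nonpos (ω : ℝ) (hr : r ≤ 0) : tent ω r = 1 := if_neg hr.not_gt

theorem tent_of_pos (ω : ℝ) (hr : 0 < r) : tent ω r = max 1 (2 * Real.exp (-(ω * r))) := if_pos hr

theorem one_le_tent (ω r : ℝ) : 1 ≤ tent ω r := by
  rcases le_or_gt r 0 with hr | hr
  · rw [tent_of_nonpos ω hr]
  · exact tent_of_pos ω hr ▸ le_max_left _ _

theorem tent_le_two (hω : 0 ≤ ω) (r : ℝ) : tent ω r ≤ 2 := by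
  rcases le_or_gt r 0 with hr | hr
  · rw [tent_of_nonpos ω hr]
    exact one_le_two
  · rw [tent_of_pos ω hr]
    have hexp : Real.exp (-(ω * r)) ≤ 1 := Real.exp_le_one_iff.2 (by nlinarith)
    exact max_le one_le_two (by linarith)

theorem tent_le_exp_mul_tent_add (hω : 0 ≤ ω) (ht : 0 ≤ t) (r : ℝ) :
    tent ω r ≤ Real.exp (ω * t) * tent ω (r + t) := by
  have hexp : 1 ≤ Real.exp (ω * t) := Real.one_le_exp (by positivity)
  have hone : 1 ≤ Real.exp (ω * t) * tent ω (r + t) :=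
    one_le_mul_of_one_le_of_one_le hexp (one_le_tent _ _)
  rcases le_or_gt r 0 with hr | hr
  · rwa [tent_of_nonpos ω hr]
  · rw [tent_of_pos ω hr]
    refine max_le hone ?_
    calc 2 * Real.exp (-(ω * r)) = Real.exp (ω * t) * (2 * Real.exp (-(ω * (r + t)))) := by
          rw [mul_left_comm, ← Real.exp_add]
          ring_nf
      _ ≤ Real.exp (ω * t) * tent ω (r + t) := by
          rw [tent_of_pos ω (by linarith)]
          gcongr
          exact le_max_right _ _

theorem two_le_exp_mul_tent (hω : 0 ≤ ω) (hr : 0 < r) (hrt : r ≤ t) :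
    2 ≤ Real.exp (ω * t) * tent ω r := by
  calc 2 ≤ 2 * Real.exp (ω * (t - r)) :=
        le_mul_of_one_le_right zero_le_two (Real.one_le_exp (mul_nonneg hω (sub_nonneg.2 hrt)))
    _ = Real.exp (ω * t) * (2 * Real.exp (-(ω * r))) := by
        rw [mul_left_comm, ← Real.exp_add]
        ring_nf
    _ ≤ Real.exp (ω * t) * tent ω r := by
        rw [tent_of_pos ω hr]
        gcongr
        exact le_max_right _ _

theorem tent_le_exp (hω : 0 ≤ ω) (hℓ : 2 ≤ Real.exp (ω * ℓ)) (ht : 0 ≤ t) (hr : r ≤ 0 ∨ ℓ ≤ r + t) :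
    tent ω r ≤ Real.exp (ω * t) := by
  have hexp : 1 ≤ Real.exp (ω * t) := Real.one_le_exp (by positivity)
  rcases le_or_gt r 0 with hr0 | hr0
  · rwa [tent_of_nonpos ω hr0]
  · rw [tent_of_pos ω hr0, Real.exp_neg]
    refine max_le hexp ((mul_inv_le_iff₀ (Real.exp_pos _)).2 (hℓ.trans ?_))
    rw [← Real.exp_add, ← mul_add, add_comm t]
    gcongr
    exact hr.resolve_left hr0.not_ge

theorem measurable_tent (ω : ℝ) : Measurable (tent ω) :=
  .ite measurableSet_Ioi (by fun_prop) measurable_const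

end Tent

section Weight

variable {ι : Type*} {α : ι → ℝ} {ω x t ℓ : ℝ}

/-- The upper envelope of the tents based at the points `α i`. It grows by a factor of at least two
across each of these points, and decreases at rate at most `ω`. -/
def weight (α : ι → ℝ) (ω x : ℝ) : ℝ := ⨆ i, tent ω (x - α i)

theorem tent_le_weight (hω : 0 ≤ ω) (i : ι) : tent ω (x - α i) ≤ weight α ω x :=
  le_ciSup (f := fun i => tent ω (x - α i)) ⟨2, forall_mem_range.2 fun _ => tent_le_two hω _⟩ i

theorem measurable_weight [Countable ι] (α : ι → ℝ) (ω : ℝ) : Measurable (weight α ω) :=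
  .iSup fun _ => (measurable_tent ω).comp (measurable_id.sub_const _)

variable [Nonempty ι]

theorem one_le_weight (α : ι → ℝ) (hω : 0 ≤ ω) (x : ℝ) : 1 ≤ weight α ω x :=
  (one_le_tent _ _).trans (tent_le_weight hω (Classical.arbitrary ι))

theorem weight_le_two (α : ι → ℝ) (hω : 0 ≤ ω) (x : ℝ) : weight α ω x ≤ 2 :=
  ciSup_le fun _ => tent_le_two hω _

theorem weight_le_exp_mul_weight_add (α : ι → ℝ) (hω : 0 ≤ ω) (ht : 0 ≤ t) (x : ℝ) :
    weight α ω x ≤ Real.exp (ω * t) * weight α ω (x + t) := by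
  refine ciSup_le fun i => (tent_le_exp_mul_tent_add hω ht _).trans ?_
  gcongr
  rw [sub_add_eq_add_sub]
  exact tent_le_weight hω i

theorem two_mul_weight_le (hω : 0 ≤ ω) (hℓ : 2 ≤ Real.exp (ω * ℓ))
    (hα : Pairwise fun i j => ℓ ≤ |α i - α j|) {i : ι} (hx : x ≤ α i) (hxt : α i < x + t) :
    2 * weight α ω x ≤ Real.exp (2 * ω * t) * weight α ω (x + t) := by
  have hbefore : weight α ω x ≤ Real.exp (ω * t) := by
    refine ciSup_le fun j => tent_le_exp hω hℓ (by linarith) ?_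
    rcases le_or_gt x (α j) with hj | hj
    · exact .inl (sub_nonpos.2 hj)
    · have hji : α j < α i := hj.trans_le hx
      have hgap : ℓ ≤ |α j - α i| := hα (show j ≠ i from fun h => hji.ne (congrArg α h))
      rw [abs_of_neg (sub_neg.2 hji)] at hgap
      exact .inr (by linarith)
  have hafter : 2 ≤ Real.exp (ω * t) * weight α ω (x + t) :=
    (two_le_exp_mul_tent hω (by linarith) (by linarith)).trans
      (mul_le_mul_of_nonneg_left (tent_le_weight hω i) (Real.exp_pos _).le)
  calc 2 * weight α ω x ≤ (Real.exp (ω * t) * weight α ω (x + t)) * Real.exp (ω * t) :=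
        mul_le_mul hafter hbefore (zero_le_one.trans (one_le_weight α hω x)) (by linarith)
    _ = Real.exp (2 * ω * t) * weight α ω (x + t) := by
        rw [mul_assoc 2, two_mul, Real.exp_add]
        ring

end Weight

section WeightedNorm

variable {u : ℝ → ℝ} {C c t E : ℝ}

/-- The squared norm in the weighted space `L²(ℝ₊, u(x) dx)`. -/
def weightedSq (u : ℝ → ℝ) (f : L2) : ℝ := ∫ x, u x * ‖zeroExt f x‖ ^ 2

theorem weightedSq_eq_integral_halfLine (u : ℝ → ℝ) (f : L2) :
    weightedSq u f = ∫ x, u x * ‖f x‖ ^ 2 ∂halfLine := by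
  rw [weightedSq, ← integral_indicator measurableSet_Ici]
  refine integral_congr_ae (.of_forall fun x => ?_)
  by_cases hx : x ∈ Ici (0 : ℝ)
  · simp only [indicator_of_mem hx, zeroExt_of_nonneg f hx]
  · simp [indicator_of_notMem hx, zeroExt_of_neg f (not_le.1 hx)]

theorem integral_norm_sq_zeroExt (f : L2) : ∫ x, ‖zeroExt f x‖ ^ 2 = ‖f‖ ^ 2 := by
  rw [Lp.norm_def, sq_toReal_eLpNorm_two (Lp.memLp f)]
  simpa only [weightedSq, one_mul] using weightedSq_eq_integral_halfLine (fun _ => 1) f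

theorem integrable_norm_sq_zeroExt (f : L2) : Integrable fun x => ‖zeroExt f x‖ ^ 2 :=
  (memLp_zeroExt f).integrable_norm_pow two_ne_zero

theorem integrable_mul_norm_sq_zeroExt (hu : Measurable u) (h0 : ∀ x, 0 ≤ u x)
    (huC : ∀ x, u x ≤ C) (f : L2) : Integrable fun x => u x * ‖zeroExt f x‖ ^ 2 :=
  (integrable_norm_sq_zeroExt f).bdd_mul hu.aestronglyMeasurable
    (.of_forall fun x => (Real.norm_of_nonneg (h0 x)).trans_le (huC x))

theorem exists_equiv_norm_sq_eq_weightedSq (hu : Measurable u) (hc : 0 < c) (hcu : ∀ x, c ≤ u x)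
    (huC : ∀ x, u x ≤ C) : ∃ A : L2 ≃L[ℂ] L2, ∀ f, ‖A f‖ ^ 2 = weightedSq u f := by
  obtain ⟨A, hA⟩ := exists_equiv_norm_sq_eq_integral (μ := halfLine) hu hc hcu huC
  exact ⟨A, fun f => (hA f).trans (weightedSq_eq_integral_halfLine u f).symm⟩

theorem weightedSq_rightShift (u : ℝ → ℝ) (ht : 0 ≤ t) (g : L2) :
    weightedSq u (rightShift t g) = weightedSq (fun x => u (x + t)) g := by
  rw [weightedSq, weightedSq,
    ← integral_sub_right_eq_self (fun x => u (x + t) * ‖zeroExt g x‖ ^ 2) t]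
  refine integral_congr_ae ?_
  filter_upwards [zeroExt_rightShift ht g] with x hx
  rw [hx, sub_add_cancel]

variable {J : Set ℤ} {a : ℤ → ℝ}

theorem norm_V_sq_le (ha : IsLacunarySeq J a) (t : ℝ) (g : L2) :
    ‖V J a ha t g‖ ^ 2 ≤ weightedSq ((crossing J a t).indicator 1) g := by
  have hg := (Lp.memLp g).restrict (crossing J a t)
  have hle := ENNReal.toReal_mono hg.eLpNorm_ne_top (enorm_V_le ha t g)
  rw [toReal_enorm] at hle
  refine (pow_le_pow_left₀ (norm_nonneg _) hle 2).trans_eq ?_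
  rw [sq_toReal_eLpNorm_two hg, weightedSq_eq_integral_halfLine,
    ← integral_indicator (measurableSet_crossing J a t)]
  refine integral_congr_ae (.of_forall fun x => ?_)
  by_cases hx : x ∈ crossing J a t <;> simp [hx]

theorem norm_add_sq_le_two_mul (z w : ℂ) : ‖z + w‖ ^ 2 ≤ 2 * ‖z‖ ^ 2 + 2 * ‖w‖ ^ 2 :=
  (pow_le_pow_left₀ (norm_nonneg _) (norm_add_le z w) 2).trans
    (by nlinarith [sq_nonneg (‖z‖ - ‖w‖)])

theorem weightedSq_leftShift_add_V_le (ha : IsLacunarySeq J a) (hu : Measurable u)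
    (h0 : ∀ x, 0 ≤ u x) (h2 : ∀ x, u x ≤ 2) (hE : ∀ x, u x ≤ E * u (x + t))
    (hcross : ∀ x, (crossed J a x t).Nonempty → 2 * u x ≤ E * u (x + t)) (f g : L2) :
    weightedSq u (leftShift t f + V J a ha t g) ≤
      E * weightedSq u f + 4 * ‖V J a ha t g‖ ^ 2 := by
  have hint : Integrable fun x => E * (u x * ‖zeroExt f x‖ ^ 2) :=
    (integrable_mul_norm_sq_zeroExt hu h0 h2 f).const_mul E
  have hintV := (integrable_norm_sq_zeroExt (V J a ha t g)).const_mul 4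
  have htranslate : E * weightedSq u f = ∫ x, E * (u (x + t) * ‖zeroExt f (x + t)‖ ^ 2) := by
    rw [weightedSq, ← integral_const_mul, ← integral_add_right_eq_self _ t]
  rw [htranslate, ← integral_norm_sq_zeroExt, weightedSq, ← integral_const_mul,
    ← integral_add (hint.comp_add_right t) hintV]
  refine integral_mono_ae (integrable_mul_norm_sq_zeroExt hu h0 h2 _)
    ((hint.comp_add_right t).add hintV) ?_
  filter_upwards [zeroExt_add (leftShift t f) (V J a ha t g), zeroExt_shift t f,
    zeroExt_V ha t g] with x hadd hshift hV
  rcases lt_or_ge x 0 with hx | hx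
  · have hEu : 0 ≤ E * u (x + t) := (h0 x).trans (hE x)
    have hF : 0 ≤ E * (u (x + t) * ‖zeroExt f (x + t)‖ ^ 2) := by
      rw [← mul_assoc]
      positivity
    simp only [zeroExt_of_neg _ hx, norm_zero]
    linarith
  rw [hadd hx, leftShift, hshift hx]
  rcases (crossed J a x t).eq_empty_or_nonempty with hempty | hne
  · rw [hV hx, hempty, finsum_mem_empty, add_zero, norm_zero]
    nlinarith [mul_le_mul_of_nonneg_right (hE x) (sq_nonneg ‖zeroExt f (x + t)‖)]
  · nlinarith [mul_le_mul_of_nonneg_right (hcross x hne) (sq_nonneg ‖zeroExt f (x + t)‖),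
      mul_le_mul_of_nonneg_left
        (norm_add_sq_le_two_mul (zeroExt f (x + t)) (zeroExt (V J a ha t g) x)) (h0 x),
      mul_le_mul_of_nonneg_right (h2 x) (sq_nonneg ‖zeroExt (V J a ha t g) x‖)]

theorem weightedSq_rightShift_add_V_le (ha : IsLacunarySeq J a) (hu : Measurable u)
    (h0 : ∀ x, 0 ≤ u x) (huC : ∀ x, u x ≤ C) (ht : 0 ≤ t) (hc : 0 ≤ c)
    (hE : ∀ x, u (x + t) ≤ E * u x)
    (hcross : ∀ x ∈ crossing J a t, u (x + t) + c ≤ E * u x) (g : L2) :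
    weightedSq u (rightShift t g) + c * ‖V J a ha t g‖ ^ 2 ≤ E * weightedSq u g := by
  have hmeas : Measurable ((crossing J a t).indicator (1 : ℝ → ℝ)) :=
    measurable_one.indicator (measurableSet_crossing J a t)
  have hind : ∀ x, (crossing J a t).indicator (1 : ℝ → ℝ) x ≤ 1 :=
    indicator_le_self' (fun _ _ => zero_le_one)
  have hintu : Integrable fun x => u (x + t) * ‖zeroExt g x‖ ^ 2 :=
    integrable_mul_norm_sq_zeroExt (by fun_prop) (fun x => h0 _) (fun x => huC _) g
  have hintc := (integrable_mul_norm_sq_zeroExt hmeas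
    (indicator_nonneg fun _ _ => zero_le_one) hind g).const_mul c
  refine (add_le_add_right (mul_le_mul_of_nonneg_left (norm_V_sq_le ha t g) hc) _).trans ?_
  rw [weightedSq_rightShift u ht, weightedSq, weightedSq, weightedSq, ← integral_const_mul,
    ← integral_const_mul, ← integral_add hintu hintc]
  refine integral_mono (hintu.add hintc)
    ((integrable_mul_norm_sq_zeroExt hu h0 huC g).const_mul E) fun x => ?_
  simp only [← mul_assoc, ← add_mul]
  gcongr
  by_cases hx : x ∈ crossing J a t
  · simpa [hx] using hcross x hx
  · simpa [hx] using hE x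

end WeightedNorm

/-! ### Similarity to a quasi-contraction semigroup -/

theorem norm_conjBy_le {H : Type*} [NormedAddCommGroup H] [InnerProductSpace ℂ H] {R : H ≃L[ℂ] H}
    {A : H →L[ℂ] H} {M : ℝ} (hM : 0 ≤ M) (h : ∀ x, ‖R (A x)‖ ≤ M * ‖R x‖) :
    ‖conjBy R A‖ ≤ M :=
  ContinuousLinearMap.opNorm_le_bound _ hM fun x =>
    (h (R.symm x)).trans_eq (by rw [R.apply_symm_apply])

theorem exists_equiv_norm_sq_eq_add {E F : Type*} [NormedAddCommGroup E] [NormedSpace ℂ E]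
    [NormedAddCommGroup F] [NormedSpace ℂ F] (A : E ≃L[ℂ] E) (B : F ≃L[ℂ] F) :
    ∃ R : WithLp 2 (E × F) ≃L[ℂ] WithLp 2 (E × F),
      ∀ h, ‖R h‖ ^ 2 = ‖A h.fst‖ ^ 2 + ‖B h.snd‖ ^ 2 :=
  ⟨((WithLp.prodContinuousLinearEquiv 2 ℂ E F).trans (A.prodCongr B)).trans
    (WithLp.prodContinuousLinearEquiv 2 ℂ E F).symm, fun _ => WithLp.prod_norm_sq_eq_of_L2 _⟩

section Separated

variable {J : Set ℤ} {a : ℤ → ℝ} {ω ℓ t : ℝ}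

theorem weightedSq_weight_le [Nonempty J] (ha : IsLacunarySeq J a) (hω : 0 ≤ ω)
    (hℓ : 2 ≤ Real.exp (ω * ℓ)) (hsep : Pairwise fun m n : J => ℓ ≤ |a m - a n|) (ht : 0 ≤ t)
    (f g : L2) : weightedSq (weight (fun n : J => a n) ω) (leftShift t f + V J a ha t g) ≤
      Real.exp (2 * ω * t) * weightedSq (weight (fun n : J => a n) ω) f +
        4 * ‖V J a ha t g‖ ^ 2 := by
  have hpos : ∀ x, 0 ≤ weight (fun n : J => a n) ω x :=
    fun x => zero_le_one.trans (one_le_weight _ hω x)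
  refine weightedSq_leftShift_add_V_le ha (measurable_weight _ ω) hpos (weight_le_two _ hω)
    (fun x => ?_) ?_ f g
  · refine (weight_le_exp_mul_weight_add _ hω ht x).trans (mul_le_mul_of_nonneg_right ?_ (hpos _))
    exact Real.exp_le_exp.2 (by linarith [mul_nonneg hω ht])
  · rintro x ⟨n, hn, hx, hxt⟩
    exact two_mul_weight_le (α := fun n : J => a n) hω hℓ hsep (i := ⟨n, hn⟩) hx hxt

/-- The weight on the second summand: the reflection of a weight, since `R(t)` moves functions in
the direction opposite to `L(t)`. The factor `4` absorbs the term `4 ‖V(t) g‖²` produced in the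
first summand. -/
def rightWeight (J : Set ℤ) (a : ℤ → ℝ) (ω x : ℝ) : ℝ := 4 * weight (fun n : J => -a n) ω (-x)

theorem measurable_rightWeight (J : Set ℤ) (a : ℤ → ℝ) (ω : ℝ) : Measurable (rightWeight J a ω) :=
  ((measurable_weight _ ω).comp measurable_neg).const_mul 4

theorem rightWeight_mem_Icc [Nonempty J] (a : ℤ → ℝ) (hω : 0 ≤ ω) (x : ℝ) :
    rightWeight J a ω x ∈ Icc 4 8 := by
  have h1 := one_le_weight (fun n : J => -a n) hω (-x)
  have h2 := weight_le_two (fun n : J => -a n) hω (-x)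
  constructor <;> rw [rightWeight] <;> linarith

theorem rightWeight_add_le [Nonempty J] (a : ℤ → ℝ) (hω : 0 ≤ ω) (ht : 0 ≤ t) (x : ℝ) :
    rightWeight J a ω (x + t) ≤ Real.exp (ω * t) * rightWeight J a ω x := by
  have h := weight_le_exp_mul_weight_add (fun n : J => -a n) hω ht (-(x + t))
  rw [show -(x + t) + t = -x by ring] at h
  rw [rightWeight, rightWeight]
  linarith

theorem rightWeight_add_add_four_le [Nonempty J] (hω : 0 ≤ ω) (hℓ : 2 ≤ Real.exp (ω * ℓ))
    (hsep : Pairwise fun m n : J => ℓ ≤ |a m - a n|) {x : ℝ} (hx : x ∈ crossing J a t) :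
    rightWeight J a ω (x + t) + 4 ≤ Real.exp (2 * ω * t) * rightWeight J a ω x := by
  obtain ⟨n, hn, hle, hlt⟩ := mem_crossing.1 hx
  have hsep_neg : Pairwise fun i j : J => ℓ ≤ |-a i - -a j| := fun i j hij =>
    (hsep hij.symm).trans_eq (by rw [neg_sub_neg])
  have hnode : -(x + t) ≤ -a n := by linarith
  have hnode_lt : -a n < -(x + t) + t := by linarith
  have h := two_mul_weight_le (α := fun n : J => -a n) (i := ⟨n, hn⟩) hω hℓ hsep_neg hnode hnode_lt
  have hone := one_le_weight (fun n : J => -a n) hω (-(x + t))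
  rw [show -(x + t) + t = -x by ring] at h
  rw [rightWeight, rightWeight]
  linarith

theorem weightedSq_rightWeight_le [Nonempty J] (ha : IsLacunarySeq J a) (hω : 0 ≤ ω)
    (hℓ : 2 ≤ Real.exp (ω * ℓ)) (hsep : Pairwise fun m n : J => ℓ ≤ |a m - a n|) (ht : 0 ≤ t)
    (g : L2) : weightedSq (rightWeight J a ω) (rightShift t g) + 4 * ‖V J a ha t g‖ ^ 2 ≤
      Real.exp (2 * ω * t) * weightedSq (rightWeight J a ω) g := by
  have hpos : ∀ x, 0 ≤ rightWeight J a ω x :=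
    fun x => zero_le_four.trans (rightWeight_mem_Icc a hω x).1
  refine weightedSq_rightShift_add_V_le ha (measurable_rightWeight J a ω) hpos
    (fun x => (rightWeight_mem_Icc a hω x).2) ht zero_le_four (fun x => ?_)
    (fun x => rightWeight_add_add_four_le hω hℓ hsep) g
  refine (rightWeight_add_le a hω ht x).trans (mul_le_mul_of_nonneg_right ?_ (hpos x))
  exact Real.exp_le_exp.2 (by linarith [mul_nonneg hω ht])

theorem isSQC_T_of_separated (ha : IsLacunarySeq J a) (hℓ : 0 < ℓ)
    (hsep : Pairwise fun m n : J => ℓ ≤ |a m - a n|) : IsSQC (T J a ha) := by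
  have : Nonempty J := by
    rcases ha.index with rfl | rfl | rfl <;> exact ⟨⟨0, by simp⟩⟩
  have hω : 0 ≤ ℓ⁻¹ := inv_nonneg.2 hℓ.le
  have hexp : 2 ≤ Real.exp (ℓ⁻¹ * ℓ) := by
    rw [inv_mul_cancel₀ hℓ.ne']
    linarith [Real.add_one_le_exp 1]
  obtain ⟨A, hA⟩ := exists_equiv_norm_sq_eq_weightedSq (measurable_weight (fun n : J => a n) ℓ⁻¹)
    one_pos (one_le_weight _ hω) (weight_le_two _ hω)
  obtain ⟨B, hB⟩ := exists_equiv_norm_sq_eq_weightedSq (measurable_rightWeight J a ℓ⁻¹)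
    four_pos (fun x => (rightWeight_mem_Icc a hω x).1) (fun x => (rightWeight_mem_Icc a hω x).2)
  obtain ⟨R, hR⟩ := exists_equiv_norm_sq_eq_add A B
  refine ⟨isC0Semigroup_T ha, R, (isC0Semigroup_T ha).conjBy R, ℓ⁻¹, fun t ht =>
    norm_conjBy_le (Real.exp_pos _).le fun h => ?_⟩
  have hleft := weightedSq_weight_le ha hω hexp hsep ht h.fst h.snd
  have hright := weightedSq_rightWeight_le ha hω hexp hsep ht h.snd
  refine le_of_sq_le_sq ?_ (by positivity)
  rw [mul_pow, ← Real.exp_nat_mul, hR, hR, hA, hA, hB, hB, Nat.cast_ofNat, ← mul_assoc 2]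
  simp only [T_eq_upperBlock, upperBlock_apply, WithLp.toLp_fst, WithLp.toLp_snd]
  linarith

theorem isSQC_T_of_Ici (ha : IsLacunarySeq (Ici 0) a) : IsSQC (T (Ici 0) a ha) := by
  refine isSQC_T_of_separated ha (ha.pos 0 self_mem_Ici) fun m n hmn => ?_
  have hgap : ∀ {m n : ℤ}, 0 ≤ m → 0 ≤ n → m < n → a 0 ≤ a n - a m := fun hm hn h => by
    linarith [ha.two_mul_le_of_lt hm hn h, ha.le_of_le self_mem_Ici hm hm]
  rcases (Subtype.coe_ne_coe.2 hmn).lt_or_gt with h | h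
  · exact le_abs.2 (.inr (by linarith [hgap m.2 n.2 h]))
  · exact le_abs.2 (.inl (hgap n.2 m.2 h))

end Separated

end PackelSemigroup

end

theorem mainTheorem11 (J : Set ℤ) (a : ℤ → ℝ) (ha : PackelSemigroup.IsLacunarySeq J a) :
    PackelSemigroup.IsC0Semigroup (PackelSemigroup.T J a ha) ∧
    (∀ t : ℝ, 0 < t →
      (PackelSemigroup.IsSimilarToContraction (PackelSemigroup.T J a ha t) ↔ J = Set.Iic 0)) ∧
    (PackelSemigroup.IsSQC (PackelSemigroup.T J a ha) ↔ J = Set.Ici 0) := by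
  refine ⟨PackelSemigroup.isC0Semigroup_T ha, fun t ht => ⟨fun hsim => ?_, ?_⟩, fun hsqc => ?_, ?_⟩
  · by_contra hJ
    refine PackelSemigroup.not_isSimilarToContraction_T ha (fun n hn => ?_) ht hsim
    rcases ha.index with rfl | rfl | rfl
    exacts [trivial, hn, absurd rfl hJ]
  · rintro rfl
    exact PackelSemigroup.isSimilarToContraction_T ha
      (fun n hn => ha.le_of_le hn Set.self_mem_Iic hn) ht
  · by_contra hJ
    refine PackelSemigroup.not_isSQC_T ha (fun n hn => ?_) hsqc
    rcases ha.index with rfl | rfl | rfl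
    exacts [trivial, absurd rfl hJ, hn]
  · rintro rfl
    exact PackelSemigroup.isSQC_T_of_Ici ha
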